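/- Let $\mu$ be any Borel probability measure on $\mathbb C$, let $X_1,X_2,\dots$ be i.i.d. complex random variables with law $\mu$, and put $P_n(z)=\prod_{i=1}^n (z-X_i)$. Let $k=k(n)$ be a sequence of nonnegative integers such that $k(n)\le \dfrac{\log n}{5\log\log n}$ for all sufficiently large $n$, and let $$\mu_n^{(k)}:=\frac1{n-k}\sum_{z\in\mathbb C:\,P_n^{(k)}(z)=0}\delta_z$$ be the empirical measure of the zeros of the $k$-th derivative $P_n^{(k)}$, counted with multiplicity (a random probability measure on $\mathbb C$ whenever $k<n$). Then $\mu_n^{(k)}\to\mu$ in probability as $n\to\infty$ with respect to the topology of weak convergence of measures; that is, for every weak neighbourhood $U$ of $\mu$, $\mathbb P\big(\mu_n^{(k)}\notin U\big)\to 0$. -/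

import Mathlib

open MeasureTheory ProbabilityTheory Filter Topology
open scoped NNReal

noncomputable section

namespace RandomRoots

/-- The random polynomial with roots the first `n` terms of the sequence `x`, that is
`P_n(z) = (z - x 0) ⋯ (z - x (n - 1))`. -/
def rootPoly (x : ℕ → ℂ) (n : ℕ) : Polynomial ℂ :=
  ∏ i ∈ Finset.range n, (Polynomial.X - Polynomial.C (x i))

/-- The point mass `δ_z`, as a finite measure on `ℂ`. -/
def pointMass (z : ℂ) : FiniteMeasure ℂ :=
  ⟨Measure.dirac z, inferInstance⟩

/-- The empirical measure of the zeros of the `k`-th derivative of `P_n`: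
`μ_n^{(k)} = (n - k)⁻¹ ∑_{z : P_n^{(k)}(z) = 0} δ_z`, the zeros being repeated according to
multiplicity. It is a probability measure when `k < n`, and the zero measure when `n ≤ k`. -/
def zeroMeasure (x : ℕ → ℂ) (n k : ℕ) : FiniteMeasure ℂ :=
  ((n - k : ℕ) : ℝ≥0)⁻¹ •
    ((Polynomial.derivative^[k] (rootPoly x n)).roots.map pointMass).sum

/-- Convergence in probability of random elements `Y n` of a topological space to a deterministic
point `c`: for every neighbourhood `U` of `c`, the probability that `Y n` is not in `U` tends
to `0`. For a (pseudo)metrizable space this says that `dist (Y n) c → 0` in probability. -/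
def TendstoInProbability {Ω E : Type*} [MeasurableSpace Ω] [TopologicalSpace E]
    (P : Measure Ω) (Y : ℕ → Ω → E) (c : E) : Prop :=
  ∀ U ∈ 𝓝 c, Tendsto (fun n => P {ω | Y n ω ∉ U}) atTop (𝓝 0)

end RandomRoots

end

/-!
The zeros of `P_n^{(k)}` and of `P_n` are compared through their logarithmic potentials: everything
follows from the fact that `n⁻¹ log |P_n^{(k)} / P_n|` tends to `0` in probability in `L¹` of every
disc (`tendsto_measure_integral_logRatio`), unless `μ` is a point mass, in which case all zeros of
`P_n` and `P_n^{(k)}` sit at the same point almost surely.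

*Size of the ratio.* One has `P_n^{(k)}(z) / P_n(z) = k! e_k(1 / (z - X_1), …, 1 / (z - X_n))`, with
`e_k` the `k`-th elementary symmetric function. Since `k! |e_k(y)| ≤ (∑ |y_i|) ^ k` and `1 / |z|` is
locally integrable, the positive part of the logarithm of the ratio is `O(k log n)` in `L¹` of a
disc. The problem is to show that the ratio is not too small.

*Anti-concentration.* For i.i.d. `y_i` whose law is not a point mass, `|e_k(y)| ≥ κ ^ k / 2` with
probability tending to `1` for some `κ > 0` (`exists_tendsto_measureReal_elemSym_le`). The
argument is that of Erdős for the Littlewood-Offord problem. Two squares `A`, `B` of size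
`8 ^ (-k)` at macroscopic distance are charged by the law, with mass at least exponentially small
in `k`. Resample each `y_i` as one of two independent copies, by a fair coin; for about `C ^ (-k) n`
indices one copy lies in `A` and the other in `B`. Along a chain of sets of indices for which
the copy in `A` is chosen, `e_k` is a complex sequence whose `k`-fold difference, twisted by factors
close to `1`, is constant; a discrete form of Rolle's theorem
(`exists_le_norm_of_twisted_difference`) shows that it cannot be small at `2 ^ k` places at once. So the
sets for which `e_k` is small contain no chain of length `2 ^ k + 1`, and by Sperner's theorem their
proportion is `O(2 ^ k / √N)` among the subsets of a set of size `N`.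

*From a point to a disc.* If the ratio is not small at one point `c`, then its logarithm is not very
negative in the mean over a disc around `c`, as `log |P_n^{(k)}|` is subharmonic and `log |P_n|` is
at most its value at `c` plus the contribution of the roots in the disc
(`setIntegral_abs_logRatio_le`). A disc of fixed radius is covered by small discs of radius `ρ`
whose centres are chosen so that this contribution is `O(n)` in total, in the mean; weighted with
the area of the small discs, it is negligible as `ρ → 0`.

*From potentials to measures.* By Jensen's formula, the difference of the means of `log |Q|` over the
discs of radii `2R` and `R` around `c` is the sum over the roots `w` of `Q` of `bump R ‖c - w‖`, a
continuous, nonnegative, compactly supported function of `w`. So the integrals of the bumps against the zero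
measure of `P_n^{(k)}` are close to those against the empirical measure of the `X_i`, hence, by the
law of large numbers, to those against `μ`. The bumps of all centres and radii determine weak
convergence of probability measures (`le_nhds_of_tendsto_bump`), because compactly supported
functions are uniform limits of their convolutions with bumps. That lemma is stated for a filter of
measures, and is applied to the filter of the sets to which `μ_n^{(k)}` belongs with probability
tending to `1`.
-/

open scoped ENNReal BoundedContinuousFunction

namespace RandomRoots

/-! ### A discrete Rolle theorem for twisted differences -/

/-- The closed convex cone `{z : |Im z| ≤ θ Re z}` around the positive half-line. -/
def Cone (θ : ℝ) (z : ℂ) : Prop := 0 ≤ z.re ∧ |z.im| ≤ θ * z.re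

lemma Cone.mono {θ φ : ℝ} {z : ℂ} (h : Cone θ z) (hθ : θ ≤ φ) : Cone φ z :=
  ⟨h.1, h.2.trans (mul_le_mul_of_nonneg_right hθ h.1)⟩

lemma Cone.add {θ : ℝ} {z w : ℂ} (hz : Cone θ z) (hw : Cone θ w) : Cone θ (z + w) := by
  refine ⟨add_nonneg hz.1 hw.1, ?_⟩
  rw [Complex.add_im, Complex.add_re, mul_add]
  exact (abs_add_le _ _).trans (add_le_add hz.2 hw.2)

lemma Cone.zero (θ : ℝ) : Cone θ 0 := by simp [Cone]

lemma Cone.sum {ι : Type*} {θ : ℝ} {s : Finset ι} {f : ι → ℂ} (h : ∀ i ∈ s, Cone θ (f i)) :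
    Cone θ (∑ i ∈ s, f i) :=
  Finset.sum_induction f (Cone θ) (fun _ _ => Cone.add) (Cone.zero θ) h

lemma Cone.norm_le {θ : ℝ} {z : ℂ} (h : Cone θ z) : ‖z‖ ≤ (1 + θ) * z.re := by
  have h1 := Complex.norm_le_abs_re_add_abs_im z
  rw [abs_of_nonneg h.1] at h1
  linarith [h.2]

/-- Multiplying elements of two narrow cones adds the slopes, up to a factor `1 + O(θφ)`. -/
lemma Cone.mul {θ φ : ℝ} {z w : ℂ} (hz : Cone θ z) (hw : Cone φ w) (hθ : 0 ≤ θ) (hφ : 0 ≤ φ)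
    (hθφ : θ * φ ≤ 1 / 4) : Cone (4 / 3 * (θ + φ)) (z * w) := by
  obtain ⟨h1, h2⟩ := hz
  obtain ⟨h3, h4⟩ := hw
  have hp : 0 ≤ z.re * w.re := mul_nonneg h1 h3
  have him : |z.im * w.im| ≤ θ * φ * (z.re * w.re) := by
    rw [abs_mul]
    calc |z.im| * |w.im| ≤ (θ * z.re) * (φ * w.re) := by gcongr
      _ = _ := by ring
  have him' : |z.im * w.im| ≤ 1 / 4 * (z.re * w.re) :=
    him.trans (mul_le_mul_of_nonneg_right hθφ hp)
  have hre : 3 / 4 * (z.re * w.re) ≤ (z * w).re := by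
    rw [Complex.mul_re]
    linarith [le_abs_self (z.im * w.im)]
  refine ⟨le_trans (by positivity) hre, ?_⟩
  have h5 : |(z * w).im| ≤ (θ + φ) * (z.re * w.re) := by
    rw [Complex.mul_im]
    calc |z.re * w.im + z.im * w.re| ≤ |z.re * w.im| + |z.im * w.re| := abs_add_le _ _
      _ = z.re * |w.im| + |z.im| * w.re := by
        rw [abs_mul, abs_mul, abs_of_nonneg h1, abs_of_nonneg h3]
      _ ≤ z.re * (φ * w.re) + (θ * z.re) * w.re := by gcongr
      _ = _ := by ring
  calc _ ≤ (θ + φ) * (z.re * w.re) := h5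
    _ ≤ (θ + φ) * (4 / 3 * (z * w).re) :=
      mul_le_mul_of_nonneg_left (by linarith) (by positivity)
    _ = _ := by ring

/-- `D` has a small weighted mean over `[x, y]`: there are weights in the cone of slope `θ`,
supported in `[x, y]` and not all zero, for which the weighted mean of `D` has modulus at most
`ρ`. -/
def SmallMean (D : ℕ → ℂ) (θ ρ : ℝ) (x y : ℕ) : Prop :=
  ∃ (s : Finset ℕ) (w : ℕ → ℂ), (∀ m ∈ s, x ≤ m ∧ m ≤ y) ∧ (∀ m ∈ s, Cone θ (w m)) ∧
    0 < (∑ m ∈ s, w m).re ∧ ‖∑ m ∈ s, w m * D m‖ ≤ ρ * ‖∑ m ∈ s, w m‖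

/-- Subtracting the small means of `D` over two consecutive intervals gives a small mean of the
sequence `D'` of normalised differences of `D`: an element of the second interval minus an
element of the first is a sum of differences, and the weights that result are again in a
cone. -/
lemma SmallMean.combine {D D' u : ℕ → ℂ} {θ ρ : ℝ} {x y x' y' : ℕ} (hθ : 0 ≤ θ)
    (hθ' : θ ≤ 1 / 32) (hρ : 0 ≤ ρ)
    (hD : ∀ m, D (m + 1) - D m = u m * D' m) (hu : ∀ m, ‖u m - 1‖ ≤ 1 / 8)
    (huθ : ∀ m, Cone θ (u m))
    (h : SmallMean D θ ρ x y) (h' : SmallMean D θ ρ x' y') (hyx : y < x') :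
    SmallMean D' (8 * θ) (4 * ρ) x y' := by
  obtain ⟨s, w, hs, hw, hW, hwD⟩ := h
  obtain ⟨s', w', hs', hw', hW', hwD'⟩ := h'
  set W := ∑ m ∈ s, w m with hWdef
  set W' := ∑ m ∈ s', w' m with hWdef'
  -- the new weight of `t` collects all pairs `l ≤ t < m`
  set v : ℕ → ℂ := fun t => u t * ∑ l ∈ s, ∑ m ∈ s', if l ≤ t ∧ t < m then w l * w' m else 0
    with hv
  have hprod : ∀ l ∈ s, ∀ m ∈ s', Cone (8 / 3 * θ) (w l * w' m) := fun l hl m hm =>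
    ((hw l hl).mul (hw' m hm) hθ hθ (by nlinarith)).mono (by linarith)
  have hmulu : ∀ t z, Cone (8 / 3 * θ) z → Cone (8 * θ) (u t * z) := fun t z hz =>
    ((huθ t).mul hz hθ (by linarith) (by nlinarith)).mono (by linarith)
  have hvc : ∀ t, Cone (8 * θ) (v t) := by
    intro t
    refine hmulu t _ (Cone.sum fun l hl => Cone.sum fun m hm => ?_)
    split_ifs
    · exact hprod l hl m hm
    · exact Cone.zero _
  -- at `t = y` every pair contributes
  have hvy : v y = u y * (W * W') := by
    simp only [hv]
    congr 1
    rw [hWdef, hWdef', Finset.sum_mul_sum]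
    refine Finset.sum_congr rfl fun l hl => Finset.sum_congr rfl fun m hm => ?_
    rw [if_pos ⟨(hs l hl).2, hyx.trans_le (hs' m hm).1⟩]
  have hsne : s.Nonempty := by
    rw [Finset.nonempty_iff_ne_empty]; rintro rfl; simp [hWdef] at hW
  have hsne' : s'.Nonempty := by
    rw [Finset.nonempty_iff_ne_empty]; rintro rfl; simp [hWdef'] at hW'
  have hxy : x ≤ y := by obtain ⟨m, hm⟩ := hsne; exact (hs m hm).1.trans (hs m hm).2
  have hxy' : x' ≤ y' := by obtain ⟨m, hm⟩ := hsne'; exact (hs' m hm).1.trans (hs' m hm).2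
  have hymem : y ∈ Finset.Ico x y' := Finset.mem_Ico.2 ⟨hxy, by omega⟩
  have hWne : 0 < ‖W‖ := norm_pos_iff.2 fun h => by rw [h] at hW; simp at hW
  have hWne' : 0 < ‖W'‖ := norm_pos_iff.2 fun h => by rw [h] at hW'; simp at hW'
  have huy : 7 / 8 ≤ ‖u y‖ := by
    have h1 := norm_sub_norm_le (1 : ℂ) (1 - u y)
    rw [norm_one, sub_sub_cancel, norm_sub_rev] at h1
    linarith [hu y]
  have hyre : ‖W‖ * ‖W'‖ ≤ 2 * (v y).re := by
    have h1 := (hvc y).norm_le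
    rw [hvy, norm_mul, norm_mul] at h1
    have h2 : 0 ≤ (v y).re := (hvc y).1
    rw [← hvy] at h1
    have h3 : 7 / 8 * (‖W‖ * ‖W'‖) ≤ ‖u y‖ * (‖W‖ * ‖W'‖) := by gcongr
    nlinarith
  have hre : (v y).re ≤ (∑ t ∈ Finset.Ico x y', v t).re := by
    rw [Complex.re_sum]
    exact Finset.single_le_sum (f := fun t => (v t).re) (fun t _ => (hvc t).1) hymem
  have hWW := mul_pos hWne hWne'
  refine ⟨Finset.Ico x y', v, fun m hm => ?_, fun m _ => hvc m, by linarith, ?_⟩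
  · rw [Finset.mem_Ico] at hm; omega
  have key : ∑ t ∈ Finset.Ico x y', v t * D' t
      = W * ∑ m ∈ s', w' m * D m - W' * ∑ l ∈ s, w l * D l := by
    have e1 : W * ∑ m ∈ s', w' m * D m - W' * ∑ l ∈ s, w l * D l
        = ∑ l ∈ s, ∑ m ∈ s', w l * w' m * (D m - D l) := by
      rw [hWdef, hWdef', Finset.sum_mul_sum, Finset.sum_mul_sum, Finset.sum_comm (s := s'),
        ← Finset.sum_sub_distrib]
      refine Finset.sum_congr rfl fun l _ => ?_
      rw [← Finset.sum_sub_distrib]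
      exact Finset.sum_congr rfl fun m _ => by ring
    have e2 : ∀ l ∈ s, ∀ m ∈ s', D m - D l
        = ∑ t ∈ Finset.Ico x y', if l ≤ t ∧ t < m then u t * D' t else 0 := by
      intro l hl m hm
      have hlm : l ≤ m := by have := hs l hl; have := hs' m hm; omega
      rw [← Finset.sum_filter, ← Finset.sum_Ico_sub D hlm]
      refine Finset.sum_congr ?_ fun t _ => hD t
      ext t
      have := hs l hl; have := hs' m hm
      simp only [Finset.mem_Ico, Finset.mem_filter]
      omega
    rw [e1]
    calc ∑ t ∈ Finset.Ico x y', v t * D' t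
        = ∑ t ∈ Finset.Ico x y', ∑ l ∈ s, ∑ m ∈ s',
            w l * w' m * (if l ≤ t ∧ t < m then u t * D' t else 0) := by
          refine Finset.sum_congr rfl fun t _ => ?_
          simp only [hv, Finset.mul_sum, Finset.sum_mul]
          refine Finset.sum_congr rfl fun l _ => Finset.sum_congr rfl fun m _ => ?_
          split_ifs <;> ring
      _ = _ := by
          rw [Finset.sum_comm]
          refine Finset.sum_congr rfl fun l hl => ?_
          rw [Finset.sum_comm]
          refine Finset.sum_congr rfl fun m hm => ?_
          rw [e2 l hl m hm, Finset.mul_sum]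
  rw [key]
  have hn : (∑ t ∈ Finset.Ico x y', v t).re ≤ ‖∑ t ∈ Finset.Ico x y', v t‖ :=
    Complex.re_le_norm _
  calc _ ≤ ‖W‖ * (ρ * ‖W'‖) + ‖W'‖ * (ρ * ‖W‖) := by
        refine (norm_sub_le _ _).trans ?_
        rw [norm_mul, norm_mul]
        gcongr
    _ = 2 * ρ * (‖W‖ * ‖W'‖) := by ring
    _ ≤ 2 * ρ * (2 * ‖∑ t ∈ Finset.Ico x y', v t‖) :=
      mul_le_mul_of_nonneg_left (by linarith) (by positivity)
    _ = _ := by ring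

/-- A discrete Rolle theorem for complex sequences: a sequence whose `k`-fold twisted difference
is constantly `1`, with twists `u` close to `1`, cannot be small at `2 ^ k` points. -/
lemma exists_le_norm_of_twisted_difference {k : ℕ} {D u : ℕ → ℕ → ℂ}
    (hD : ∀ j < k, ∀ m, D j (m + 1) - D j m = u j m * D (j + 1) m)
    (hk : ∀ m, D k m = 1) (hu : ∀ j m, ‖u j m - 1‖ ≤ 1 / (16 * 8 ^ (k + 1)))
    {x : ℕ → ℕ} (hx : StrictMono x) {δ : ℝ} (hδ : 4 ^ k * δ < 1) :
    ∃ i < 2 ^ k, δ < ‖D 0 (x i)‖ := by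
  by_contra! hcon
  have hδ0 : 0 ≤ δ := (norm_nonneg _).trans (hcon 0 (by positivity))
  set η : ℝ := 1 / (4 * 8 ^ (k + 1)) with hη
  have hη0 : 0 < η := by positivity
  have hpow : ∀ j ≤ k, (8 : ℝ) ^ j * η ≤ 1 / 32 := by
    intro j hj
    have : (8 : ℝ) ^ j ≤ 8 ^ k := pow_le_pow_right₀ (by norm_num) hj
    rw [hη, pow_succ]
    rw [mul_one_div, div_le_div_iff₀ (by positivity) (by norm_num)]
    linarith
  have hsmall : 1 / (16 * 8 ^ (k + 1)) ≤ (1 / 8 : ℝ) := by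
    have : (1 : ℝ) ≤ 8 ^ (k + 1) := one_le_pow₀ (by norm_num)
    exact one_div_le_one_div_of_le (by norm_num) (by linarith)
  have hcone : ∀ j m, Cone η (u j m) := by
    intro j m
    have h1 := (Complex.abs_re_le_norm _).trans (hu j m)
    have h2 := (Complex.abs_im_le_norm _).trans (hu j m)
    simp only [Complex.sub_re, Complex.one_re, Complex.sub_im, Complex.one_im, sub_zero] at h1 h2
    have h3 : 7 / 8 ≤ (u j m).re := by linarith [(abs_le.1 (h1.trans hsmall)).1]
    refine ⟨by linarith, h2.trans ?_⟩
    have : 1 / (16 * 8 ^ (k + 1)) = η / 4 := by rw [hη]; field_simp; norm_num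
    rw [this]
    nlinarith
  have main : ∀ j ≤ k, ∀ i < 2 ^ (k - j), SmallMean (D j) (8 ^ j * η) (4 ^ j * δ)
      (x (i * 2 ^ j)) (x ((i + 1) * 2 ^ j - 1)) := by
    intro j
    induction j with
    | zero =>
      intro _ i hi
      refine ⟨{x i}, fun _ => 1, ?_, ?_, ?_, ?_⟩
      · simp
      · intro m _
        refine ⟨by simp, ?_⟩
        simpa using hη0.le
      · simp
      · simpa using hcon i (by simpa using hi)
    | succ j ih =>
      intro hj i hi
      have hj' : j < k := hj
      have hi2 : 2 * i + 1 < 2 ^ (k - j) := by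
        have : k - j = k - (j + 1) + 1 := by omega
        rw [this, pow_succ]; omega
      have h1 := ih hj'.le (2 * i) (by omega)
      have h2 := ih hj'.le (2 * i + 1) hi2
      have hp : 0 < 2 ^ j := by positivity
      have := SmallMean.combine (u := u j) (D' := D (j + 1)) (by positivity) (hpow j hj'.le)
        (by positivity) (hD j hj') (fun m => (hu j m).trans hsmall)
        (fun m => (hcone j m).mono (le_mul_of_one_le_left hη0.le (one_le_pow₀ (by norm_num))))
        h1 h2 (hx (Nat.sub_lt (by positivity) one_pos))
      have e1 : 2 * i * 2 ^ j = i * 2 ^ (j + 1) := by ring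
      have e2 : (2 * i + 1 + 1) * 2 ^ j = (i + 1) * 2 ^ (j + 1) := by ring
      have e3 : (8 : ℝ) * (8 ^ j * η) = 8 ^ (j + 1) * η := by ring
      have e4 : (4 : ℝ) * (4 ^ j * δ) = 4 ^ (j + 1) * δ := by ring
      rwa [e1, e2, e3, e4] at this
  obtain ⟨s, w, -, -, hW, hle⟩ := main k le_rfl 0 (by positivity)
  simp only [hk, mul_one] at hle
  have hW0 : 0 < ‖∑ m ∈ s, w m‖ := hW.trans_le (Complex.re_le_norm _)
  nlinarith

/-! ### Chains of sets, and Sperner's theorem -/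

open PowerSeries in
/-- Let `a l` and `b l` be such that all differences `a l - b m` are nearly equal to `c`. Then
the coefficient of `X ^ k` in a product with factors `1 + a l X` for `l` in a set `S` and
`1 + b l X` for the other `l` cannot be small for all members `S` of a chain of `2 ^ k` sets:
along the chain, it is a sequence whose `k`-fold twisted difference is `c ^ k`. -/
lemma exists_lt_norm_coeff_of_chain {N k : ℕ} {a b : Fin N → ℂ} {A B : Set ℂ} {c : ℂ}
    (hc : c ≠ 0) (hA : A.Nonempty) (hB : B.Nonempty) (ha : ∀ l, a l ∈ A) (hb : ∀ l, b l ∈ B)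
    (hAB : ∀ x ∈ A, ∀ y ∈ B, ‖(x - y) / c - 1‖ ≤ 1 / (16 * 8 ^ (k + 1)))
    (R : PowerSeries ℂ) (hR : constantCoeff R = 1)
    {S : Fin (2 ^ k) → Finset (Fin N)} (hS : StrictMono S) {δ : ℝ} (hδ : 4 ^ k * δ < 1) :
    ∃ i, ‖c‖ ^ k * δ <
      ‖coeff k (R * ∏ l, (1 + C (if l ∈ S i then a l else b l) * X))‖ := by
  obtain ⟨α, hα⟩ := hA
  obtain ⟨β, hβ⟩ := hB
  -- order the indices so that the sets of the chain become initial segments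
  set r : Fin N → ℕ := fun l => (Finset.univ.filter fun i => l ∉ S i).card with hr
  have hmem : ∀ l i, l ∈ S i ↔ r l ≤ i := by
    intro l i
    constructor
    · intro h
      have : (Finset.univ.filter fun i => l ∉ S i) ⊆ Finset.Iio i := by
        intro i' hi'
        simp only [Finset.mem_filter, Finset.mem_univ, true_and] at hi'
        rw [Finset.mem_Iio]
        by_contra! hle
        exact hi' (hS.monotone hle h)
      simpa using Finset.card_le_card this
    · intro h
      by_contra hl
      have : Finset.Iic i ⊆ (Finset.univ.filter fun i => l ∉ S i) := by
        intro i' hi'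
        simp only [Finset.mem_filter, Finset.mem_univ, true_and]
        exact fun h' => hl (hS.monotone (Finset.mem_Iic.1 hi') h')
      have := Finset.card_le_card this
      rw [Fin.card_Iic] at this
      change _ ≤ r l at this
      omega
  set σ := Tuple.sort r with hσ
  have hmono : Monotone (r ∘ σ) := Tuple.monotone_sort r
  have hinit : ∀ i (p : Fin N), σ p ∈ S i ↔ (p : ℕ) < (S i).card := by
    intro i p
    have hcard : (S i).card = (Finset.univ.filter fun p => σ p ∈ S i).card := by
      rw [← Finset.card_map σ.toEmbedding (s := Finset.univ.filter fun p => σ p ∈ S i)]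
      congr 1
      ext q
      simp
    constructor
    · intro h
      have : Finset.Iic p ⊆ (Finset.univ.filter fun p => σ p ∈ S i) := by
        intro q hq
        simp only [Finset.mem_filter, Finset.mem_univ, true_and]
        rw [hmem] at h ⊢
        exact (hmono (Finset.mem_Iic.1 hq)).trans h
      have := Finset.card_le_card this
      rw [Fin.card_Iic, ← hcard] at this
      omega
    · intro h
      by_contra hp
      have : (Finset.univ.filter fun p => σ p ∈ S i) ⊆ Finset.Iio p := by
        intro q hq
        simp only [Finset.mem_filter, Finset.mem_univ, true_and] at hq
        rw [Finset.mem_Iio]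
        by_contra! hle
        rw [hmem] at hq hp
        exact hp ((hmono hle).trans hq)
      have := Finset.card_le_card this
      rw [Fin.card_Iio, ← hcard] at this
      omega
  set a' : ℕ → ℂ := fun l => if h : l < N then a (σ ⟨l, h⟩) else α with ha'
  set b' : ℕ → ℂ := fun l => if h : l < N then b (σ ⟨l, h⟩) else β with hb'
  have ha'A : ∀ l, a' l ∈ A := fun l => by
    simp only [ha']; split_ifs
    exacts [ha _, hα]
  have hb'B : ∀ l, b' l ∈ B := fun l => by
    simp only [hb']; split_ifs
    exacts [hb _, hβ]
  set F : ℂ → PowerSeries ℂ := fun z => 1 + C z * X with hF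
  have hF1 : ∀ z, constantCoeff (F z) = 1 := fun z => by simp [hF]
  have hFinv : ∀ z, F z * (F z)⁻¹ = 1 := fun z =>
    PowerSeries.mul_inv_cancel _ (by rw [hF1]; exact one_ne_zero)
  set T : PowerSeries ℂ := R * ∏ l ∈ Finset.range N, F (b' l) with hT
  -- the sequence of products along the initial segments, `G 0`, and its differences up to
  -- constants: each difference removes one more factor `1 + b l X` and lowers the degree by one
  set G : ℕ → ℕ → PowerSeries ℂ := fun j m =>
    T * (∏ l ∈ Finset.range m, F (a' l)) * ∏ l ∈ Finset.range (m + j), (F (b' l))⁻¹ with hG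
  have hG0 : ∀ j m, constantCoeff (G j m) = 1 := by
    intro j m
    simp [hG, hT, hR, hF1, map_mul, map_prod]
  have hGrec : ∀ j m, G j (m + 1) - G j m = C (a' m - b' (m + j)) * G (j + 1) m * X := by
    intro j m
    have e1 : m + 1 + j = m + j + 1 := by ring
    have e2 : m + (j + 1) = m + j + 1 := by ring
    simp only [hG, e1, e2, Finset.prod_range_succ]
    have h := hFinv (b' (m + j))
    set Q := (F (b' (m + j)))⁻¹
    set U := ∏ l ∈ Finset.range (m + j), (F (b' l))⁻¹
    set V := ∏ l ∈ Finset.range m, F (a' l)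
    have h2 : F (a' m) - F (b' (m + j)) = C (a' m - b' (m + j)) * X := by
      simp only [hF, map_sub]; ring
    calc _ = T * V * U * (F (a' m) * Q - 1) := by ring
      _ = T * V * U * Q * (F (a' m) - F (b' (m + j))) := by rw [← h]; ring
      _ = _ := by rw [h2]; ring
  set D : ℕ → ℕ → ℂ := fun j m => coeff (k - j) (G j m) / c ^ (k - j) with hD
  set x : ℕ → ℕ := fun i => if h : i < 2 ^ k then (S ⟨i, h⟩).card else N + i with hx
  have hcardN : ∀ i, (S i).card ≤ N := fun i => by
    simpa using Finset.card_le_univ (S i)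
  have hxm : StrictMono x := by
    intro i j hij
    simp only [hx]
    split_ifs with h1 h2 h2
    · exact Finset.card_lt_card (hS hij)
    · have := hcardN ⟨i, h1⟩; omega
    · omega
    · omega
  have hex : ∃ i < 2 ^ k, δ < ‖D 0 (x i)‖ := by
    refine exists_le_norm_of_twisted_difference (k := k) (D := D)
      (u := fun j m => (a' m - b' (m + j)) / c) ?_ ?_ ?_ hxm hδ
    · intro j hj m
      obtain ⟨q, hq⟩ : ∃ q, k - j = q + 1 := ⟨k - j - 1, by omega⟩
      have hq' : k - (j + 1) = q := by omega
      simp only [hD, hq, hq']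
      rw [← sub_div, ← map_sub, hGrec, coeff_succ_mul_X, coeff_C_mul]
      field_simp
      ring
    · intro m
      simp only [hD, Nat.sub_self, pow_zero, div_one, coeff_zero_eq_constantCoeff, hG0]
    · intro j m
      exact hAB _ (ha'A _) _ (hb'B _)
  obtain ⟨i, hi, hlt⟩ := hex
  refine ⟨⟨i, hi⟩, ?_⟩
  have hxi : x i = (S ⟨i, hi⟩).card := by simp [hx, hi]
  have hle : x i ≤ N := hxi ▸ hcardN _
  have hprod : G 0 (x i) = R * ∏ l, (1 + C (if l ∈ S ⟨i, hi⟩ then a l else b l) * X) := by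
    have e1 : ∏ l, (1 + C (if l ∈ S ⟨i, hi⟩ then a l else b l) * X)
        = ∏ p : Fin N, F (if (p : ℕ) < x i then a' p else b' p) := by
      rw [← Equiv.prod_comp σ]
      refine Finset.prod_congr rfl fun p _ => ?_
      simp only [hinit, hF, hxi, ha', hb', p.2, dite_true]
    rw [e1, Fin.prod_univ_eq_prod_range (fun p => F (if p < x i then a' p else b' p)) N,
      ← Finset.prod_range_mul_prod_Ico _ hle]
    have e2 : ∏ p ∈ Finset.range (x i), F (if p < x i then a' p else b' p)
        = ∏ p ∈ Finset.range (x i), F (a' p) :=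
      Finset.prod_congr rfl fun p hp => by rw [if_pos (Finset.mem_range.1 hp)]
    have e3 : ∏ p ∈ Finset.Ico (x i) N, F (if p < x i then a' p else b' p)
        = ∏ p ∈ Finset.Ico (x i) N, F (b' p) :=
      Finset.prod_congr rfl fun p hp => by rw [if_neg (not_lt.2 (Finset.mem_Ico.1 hp).1)]
    rw [e2, e3]
    simp only [hG, hT, add_zero]
    rw [← Finset.prod_range_mul_prod_Ico _ hle]
    have e4 : (∏ p ∈ Finset.range (x i), F (b' p)) * ∏ p ∈ Finset.range (x i), (F (b' p))⁻¹
        = 1 := by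
      rw [← Finset.prod_mul_distrib]
      exact Finset.prod_eq_one fun p _ => hFinv _
    set V1 := ∏ p ∈ Finset.range (x i), F (b' p)
    set V2 := ∏ p ∈ Finset.range (x i), (F (b' p))⁻¹
    calc _ = R * ((∏ p ∈ Finset.range (x i), F (a' p)) * ∏ p ∈ Finset.Ico (x i) N, F (b' p))
        * (V1 * V2) := by ring
      _ = _ := by rw [e4, mul_one]
  rw [← hprod]
  simp only [hD, Nat.sub_zero, norm_div, norm_pow] at hlt
  rw [lt_div_iff₀ (by positivity)] at hlt
  linarith

/-- A family of subsets of an `N`-element set that contains no chain of `s + 1` sets has at most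
`s * N.choose (N / 2)` members: it is a union of `s` antichains. -/
lemma card_le_of_no_chain {α : Type*} [Fintype α] [DecidableEq α] (s : ℕ) :
    ∀ 𝒜 : Finset (Finset α),
      (¬ ∃ S : Fin (s + 1) → Finset α, StrictMono S ∧ ∀ i, S i ∈ 𝒜) →
      𝒜.card ≤ s * (Fintype.card α).choose (Fintype.card α / 2) := by
  induction s with
  | zero =>
    intro 𝒜 h
    rw [zero_mul, Nat.le_zero, Finset.card_eq_zero, Finset.eq_empty_iff_forall_notMem]
    exact fun S hS => h ⟨fun _ => S, fun i j h => absurd (Fin.lt_def.1 h) (by omega), fun _ => hS⟩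
  | succ s ih =>
    intro 𝒜 h
    classical
    set 𝓜 := 𝒜.filter fun S => ∀ T ∈ 𝒜, ¬ T < S with h𝓜
    have hanti : IsAntichain (· ⊆ ·) (SetLike.coe 𝓜) := by
      intro S hS T hT hne hsub
      have hS' := Finset.mem_filter.1 (Finset.mem_coe.1 hS)
      have hT' := Finset.mem_filter.1 (Finset.mem_coe.1 hT)
      exact hT'.2 S hS'.1 (lt_of_le_of_ne hsub hne)
    have h1 := hanti.sperner
    have h2 := ih (𝒜 \ 𝓜) (by
      rintro ⟨S, hS, hmem⟩
      have h0 := Finset.mem_sdiff.1 (hmem 0)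
      have : ∃ T ∈ 𝒜, T < S 0 := by
        by_contra! hcon
        exact h0.2 (Finset.mem_filter.2 ⟨h0.1, hcon⟩)
      obtain ⟨T, hT, hlt⟩ := this
      refine h ⟨Fin.cons T S, ?_, ?_⟩
      · rw [Fin.strictMono_iff_lt_succ]
        intro i
        refine Fin.cases ?_ (fun i => ?_) i
        · simpa using hlt
        · rw [Fin.cons_succ, ← Fin.succ_castSucc, Fin.cons_succ]
          exact hS Fin.castSucc_lt_succ
      · intro i
        refine Fin.cases ?_ (fun i => ?_) i
        · simpa using hT
        · rw [Fin.cons_succ]; exact (Finset.mem_sdiff.1 (hmem i)).1)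
    have h3 : 𝒜.card = (𝒜 \ 𝓜).card + 𝓜.card :=
      (Finset.card_sdiff_add_card_eq_card (Finset.filter_subset _ _)).symm
    rw [h3, add_mul, one_mul]
    exact add_le_add h2 h1

lemma centralBinom_sq_mul_le (n : ℕ) : n.centralBinom ^ 2 * (2 * n + 1) ≤ 16 ^ n := by
  induction n with
  | zero => simp
  | succ n ih =>
    have h := Nat.succ_mul_centralBinom_succ n
    have h1 : (n + 1) ^ 2 * ((n + 1).centralBinom ^ 2 * (2 * (n + 1) + 1))
        = (n.centralBinom ^ 2 * (2 * n + 1)) * (4 * (2 * n + 1) * (2 * n + 3)) := by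
      calc _ = ((n + 1) * (n + 1).centralBinom) ^ 2 * (2 * (n + 1) + 1) := by ring
        _ = _ := by rw [h]; ring
    have h2 : (n.centralBinom ^ 2 * (2 * n + 1)) * (4 * (2 * n + 1) * (2 * n + 3))
        ≤ 16 ^ n * (16 * (n + 1) ^ 2) := Nat.mul_le_mul ih (by nlinarith)
    rw [← h1] at h2
    have h3 : (16 : ℕ) ^ n * (16 * (n + 1) ^ 2) = (n + 1) ^ 2 * 16 ^ (n + 1) := by ring
    rw [h3] at h2
    exact Nat.le_of_mul_le_mul_left h2 (by positivity)

/-- The middle binomial coefficient of order `n` is `O(2 ^ n / √n)`. -/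
lemma choose_half_sq_mul_le (n : ℕ) : (n.choose (n / 2)) ^ 2 * n ≤ 4 ^ n := by
  obtain ⟨m, rfl | rfl⟩ := Nat.even_or_odd' n
  · have h := centralBinom_sq_mul_le m
    rw [Nat.centralBinom_eq_two_mul_choose] at h
    rw [Nat.mul_div_cancel_left _ two_pos]
    have h2 : (4 : ℕ) ^ (2 * m) = 16 ^ m := by rw [pow_mul]; norm_num
    rw [h2]
    exact (Nat.mul_le_mul_left _ (by omega)).trans h
  · have h := centralBinom_sq_mul_le (m + 1)
    have h1 : (2 * m + 1) / 2 = m := by omega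
    have h2 : (m + 1).centralBinom = 2 * (2 * m + 1).choose m := by
      rw [Nat.centralBinom_eq_two_mul_choose, show 2 * (m + 1) = 2 * m + 1 + 1 by ring,
        Nat.choose_succ_succ, ← Nat.choose_symm_half]
      ring
    rw [h2] at h
    rw [h1]
    have h4 : (4 : ℕ) ^ (2 * m + 1) * 4 = 16 ^ (m + 1) := by
      rw [← pow_succ, show 2 * m + 1 + 1 = 2 * (m + 1) by ring, pow_mul]; norm_num
    have h5 : (2 * m + 1) ≤ 2 * (m + 1) + 1 := by omega
    have h6 := Nat.mul_le_mul_left ((2 * (2 * m + 1).choose m) ^ 2) h5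
    nlinarith

/-! ### A small-ball estimate for elementary symmetric functions -/

/-- The `k`-th elementary symmetric function of the family `y`, as the coefficient of `X ^ k` in
`∏ i, (1 + y i X)`. -/
noncomputable def elemSym {ι : Type*} [Fintype ι] (k : ℕ) (y : ι → ℂ) : ℂ :=
  (∏ i, (1 + Polynomial.C (y i) * Polynomial.X)).coeff k

lemma elemSym_eq_sum {ι : Type*} [Fintype ι] (k : ℕ) (y : ι → ℂ) :
    elemSym k y = ∑ t : Finset ι, if k = t.card then ∏ i ∈ t, y i else 0 := by
  classical
  rw [elemSym, Finset.prod_one_add, Polynomial.finsetSum_coeff, Finset.powerset_univ]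
  refine Finset.sum_congr rfl fun t _ => ?_
  rw [Finset.prod_mul_distrib, Finset.prod_const, ← map_prod, Polynomial.coeff_C_mul,
    Polynomial.coeff_X_pow, mul_ite, mul_one, mul_zero]

lemma continuous_elemSym {ι : Type*} [Fintype ι] (k : ℕ) :
    Continuous fun y : ι → ℂ => elemSym k y := by
  simp_rw [elemSym_eq_sum]
  refine continuous_finsetSum _ fun t _ => ?_
  split_ifs
  · fun_prop
  · exact continuous_const

lemma elemSym_eq_coeff {ι : Type*} [Fintype ι] (k : ℕ) (y : ι → ℂ) :
    elemSym k y = PowerSeries.coeff k (∏ i, (1 + PowerSeries.C (y i) * PowerSeries.X)) := by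
  rw [elemSym, ← Polynomial.coeff_coe, ← Polynomial.coeToPowerSeries.ringHom_apply, map_prod]
  simp

/-- Choosing `x i` for `i ∈ ξ` and `x' i` for `i ∉ ξ`. -/
def choice {n : ℕ} (x x' : Fin n → ℂ) (ξ : Finset (Fin n)) (i : Fin n) : ℂ :=
  if i ∈ ξ then x i else x' i

/-- If `x i ∈ A` and `x' i ∈ B` for `N` indices `i`, where all differences between `A` and `B`
are nearly equal, then few of the `2 ^ n` choices between `x` and `x'` make the `k`-th elementary
symmetric function small. -/
lemma card_choice_le {n k : ℕ} {x x' : Fin n → ℂ} {A B : Set ℂ} {c : ℂ}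
    (hc : c ≠ 0) (hA : A.Nonempty) (hB : B.Nonempty)
    (hAB : ∀ x ∈ A, ∀ y ∈ B, ‖(x - y) / c - 1‖ ≤ 1 / (16 * 8 ^ (k + 1)))
    {δ : ℝ} (hδ : 4 ^ k * δ < 1) (G : Finset (Fin n)) (hG : ∀ i ∈ G, x i ∈ A ∧ x' i ∈ B) :
    (Finset.univ.filter fun ξ => ‖elemSym k (choice x x' ξ)‖ ≤ ‖c‖ ^ k * δ).card
      ≤ 2 ^ k * G.card.choose (G.card / 2) * 2 ^ (n - G.card) := by
  classical
  set 𝓑 := Finset.univ.filter fun ξ => ‖elemSym k (choice x x' ξ)‖ ≤ ‖c‖ ^ k * δ with h𝓑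
  set N := G.card with hN
  set e : Fin N ↪o Fin n := G.orderEmbOfFin rfl with he
  have heG : ∀ l, e l ∈ G := fun l => G.orderEmbOfFin_mem rfl l
  have heU : Finset.univ.map e.toEmbedding = G := G.map_orderEmbOfFin_univ rfl
  have hfib : ∀ T ∈ 𝓑.image (· \ G), (𝓑.filter fun ξ => ξ \ G = T).card
      ≤ 2 ^ k * N.choose (N / 2) := by
    intro T _
    set 𝒜 : Finset (Finset (Fin N)) := Finset.univ.filter fun S =>
      ‖elemSym k (choice x x' (S.map e.toEmbedding ∪ T \ G))‖ ≤ ‖c‖ ^ k * δ with h𝒜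
    have h1 : (𝓑.filter fun ξ => ξ \ G = T).card ≤ 𝒜.card := by
      have hrec : ∀ ξ : Finset (Fin n), ξ \ G = T →
          (Finset.univ.filter fun l => e l ∈ ξ).map e.toEmbedding ∪ T \ G = ξ := by
        intro ξ hξ
        ext i
        rw [← hξ]
        simp only [Finset.mem_union, Finset.mem_map, Finset.mem_filter, Finset.mem_univ, true_and,
          Finset.mem_sdiff]
        constructor
        · rintro (⟨l, hl, rfl⟩ | h)
          · exact hl
          · exact h.1.1
        · intro hi
          by_cases hiG : i ∈ G
          · rw [← heU] at hiG
            obtain ⟨l, -, rfl⟩ := Finset.mem_map.1 hiG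
            exact Or.inl ⟨l, hi, rfl⟩
          · exact Or.inr ⟨⟨hi, hiG⟩, hiG⟩
      refine Finset.card_le_card_of_injOn (fun ξ => Finset.univ.filter fun l => e l ∈ ξ) ?_ ?_
      · intro ξ hξ
        obtain ⟨hξ1, hξ2⟩ := Finset.mem_filter.1 (Finset.mem_coe.1 hξ)
        refine Finset.mem_coe.2 (Finset.mem_filter.2 ⟨Finset.mem_univ _, ?_⟩)
        rw [hrec ξ hξ2]
        exact (Finset.mem_filter.1 hξ1).2
      · intro ξ hξ ξ' hξ' heq
        rw [← hrec ξ (Finset.mem_filter.1 (Finset.mem_coe.1 hξ)).2,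
          ← hrec ξ' (Finset.mem_filter.1 (Finset.mem_coe.1 hξ')).2]
        simp only at heq
        rw [heq]
    refine h1.trans ?_
    have := card_le_of_no_chain (2 ^ k) 𝒜 ?_
    · rwa [Fintype.card_fin] at this
    rintro ⟨S, hS, hSm⟩
    set R : PowerSeries ℂ := ∏ i ∈ Gᶜ,
      (1 + PowerSeries.C (if i ∈ T then x i else x' i) * PowerSeries.X) with hR
    obtain ⟨i, hi⟩ := exists_lt_norm_coeff_of_chain (a := x ∘ e) (b := x' ∘ e) hc hA hB
      (fun l => (hG _ (heG l)).1) (fun l => (hG _ (heG l)).2) hAB R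
      (by simp [hR, map_prod]) (S := fun i => S i.castSucc)
      (hS.comp (Fin.strictMono_castSucc)) hδ
    have h2 := (Finset.mem_filter.1 (hSm i.castSucc)).2
    refine absurd h2 (not_le.2 ?_)
    refine hi.trans_eq (congrArg norm (Eq.symm ?_))
    rw [elemSym_eq_coeff]
    congr 1
    rw [← Finset.prod_compl_mul_prod G]
    congr 1
    · refine Finset.prod_congr rfl fun j hj => ?_
      rw [Finset.mem_compl] at hj
      have : j ∉ (S i.castSucc).map e.toEmbedding := by
        intro h
        obtain ⟨l, -, rfl⟩ := Finset.mem_map.1 h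
        exact hj (heG l)
      simp [choice, this, hj]
    · rw [← heU, Finset.prod_map]
      refine Finset.prod_congr rfl fun l _ => ?_
      simp [choice]
  refine (Finset.card_le_mul_card_image 𝓑 _ hfib).trans ?_
  refine Nat.mul_le_mul_left _ ?_
  have : 𝓑.image (· \ G) ⊆ Gᶜ.powerset := by
    intro T hT
    obtain ⟨ξ, -, rfl⟩ := Finset.mem_image.1 hT
    rw [Finset.mem_powerset]
    intro i hi
    exact Finset.mem_compl.2 (Finset.mem_sdiff.1 hi).2
  refine (Finset.card_le_card this).trans ?_
  rw [Finset.card_powerset, Finset.card_compl, Fintype.card_fin]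

/-- Small-ball estimate for elementary symmetric functions of i.i.d. variables with law `ν`. The
second term bounds the probability that fewer than `N₀` of `n` independent pairs fall into
`A × B`. -/
lemma measureReal_elemSym_le (ν : Measure ℂ) [IsProbabilityMeasure ν] {n k : ℕ} {A B : Set ℂ}
    (hAm : MeasurableSet A) (hBm : MeasurableSet B) {c : ℂ} (hc : c ≠ 0)
    (hA : A.Nonempty) (hB : B.Nonempty)
    (hAB : ∀ x ∈ A, ∀ y ∈ B, ‖(x - y) / c - 1‖ ≤ 1 / (16 * 8 ^ (k + 1)))
    {δ : ℝ} (hδ : 4 ^ k * δ < 1) {N₀ : ℕ} (hN₀ : 0 < N₀) :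
    (Measure.pi fun _ : Fin n => ν).real {y | ‖elemSym k y‖ ≤ ‖c‖ ^ k * δ}
      ≤ 2 ^ k / √N₀ + 2 ^ N₀ * (1 - ν.real A * ν.real B / 2) ^ n := by
  classical
  set S : Set (Fin n → ℂ) := {y | ‖elemSym k y‖ ≤ ‖c‖ ^ k * δ} with hS
  have hSm : MeasurableSet S :=
    measurableSet_le (continuous_elemSym k).norm.measurable measurable_const
  set M : Measure (Fin n → ℂ × ℂ) := Measure.pi fun _ => ν.prod ν with hM
  set sel : Finset (Fin n) → (Fin n → ℂ × ℂ) → Fin n → ℂ :=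
    fun ξ q => choice (fun i => (q i).1) (fun i => (q i).2) ξ with hsel
  have hmp : ∀ ξ, MeasurePreserving (sel ξ) M (Measure.pi fun _ => ν) := by
    intro ξ
    have := measurePreserving_pi (fun _ : Fin n => ν.prod ν) (fun _ : Fin n => ν)
      (f := fun i z => if i ∈ ξ then z.1 else z.2) (fun i => by
        by_cases h : i ∈ ξ
        · simpa [h] using measurePreserving_fst
        · simpa [h] using measurePreserving_snd)
    exact this
  set φ : ℂ × ℂ → ℝ := fun z => if z ∈ A ×ˢ B then 1 / 2 else 1 with hφ
  have hABm : MeasurableSet (A ×ˢ B) := hAm.prod hBm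
  have hφm : Measurable φ := Measurable.ite hABm measurable_const measurable_const
  have hφ0 : ∀ z, 0 ≤ φ z := fun z => by simp only [hφ]; split_ifs <;> norm_num
  have hφ1 : ∀ z, φ z ≤ 1 := fun z => by simp only [hφ]; split_ifs <;> norm_num
  have hφint : ∫ z, φ z ∂(ν.prod ν) = 1 - ν.real A * ν.real B / 2 := by
    have e : φ = fun z => 1 - (A ×ˢ B).indicator (fun _ => (1 / 2 : ℝ)) z := by
      funext z
      simp only [hφ, Set.indicator]
      split_ifs <;> norm_num
    rw [e, integral_sub (integrable_const _) ((integrable_const _).indicator hABm),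
      integral_indicator_const _ hABm, measureReal_prod_prod]
    simp
    ring
  have hpt : ∀ q : Fin n → ℂ × ℂ,
      ∑ ξ : Finset (Fin n), (sel ξ ⁻¹' S).indicator (fun _ => (1 : ℝ)) q
        ≤ 2 ^ n * (2 ^ k / √N₀ + 2 ^ N₀ * ∏ i, φ (q i)) := by
    intro q
    set G : Finset (Fin n) := Finset.univ.filter fun i => q i ∈ A ×ˢ B with hG
    have hprod : ∏ i, φ (q i) = (1 / 2 : ℝ) ^ G.card := by
      simp only [hφ]
      rw [Finset.prod_ite, Finset.prod_const_one, mul_one, Finset.prod_const]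
    have hcount : ∑ ξ : Finset (Fin n), (sel ξ ⁻¹' S).indicator (fun _ => (1 : ℝ)) q
        = ((Finset.univ.filter fun ξ => ‖elemSym k (choice (fun i => (q i).1)
            (fun i => (q i).2) ξ)‖ ≤ ‖c‖ ^ k * δ).card : ℝ) := by
      rw [Finset.card_filter, Nat.cast_sum]
      refine Finset.sum_congr rfl fun ξ _ => ?_
      simp only [Set.indicator, Set.mem_preimage, hS, Set.mem_ofPred_eq, hsel]
      split_ifs <;> simp
    rw [hcount, hprod]
    have hGn : G.card ≤ n := by simpa using Finset.card_le_univ G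
    rcases le_or_gt N₀ G.card with h | h
    · have h1 := card_choice_le (x := fun i => (q i).1) (x' := fun i => (q i).2) hc hA hB hAB hδ G
        (fun i hi => by simpa using (Finset.mem_filter.1 hi).2)
      have h2 : (G.card.choose (G.card / 2) : ℝ) * √N₀ ≤ 2 ^ G.card := by
        have h3 : ((G.card.choose (G.card / 2) : ℝ)) ^ 2 * G.card ≤ 4 ^ G.card := by
          exact_mod_cast choose_half_sq_mul_le G.card
        refine abs_le_of_sq_le_sq' ?_ (by positivity) |>.2
        rw [mul_pow, Real.sq_sqrt (by positivity), ← pow_mul, mul_comm, mul_comm _ 2, pow_mul]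
        have h4 : (N₀ : ℝ) ≤ G.card := by exact_mod_cast h
        norm_num
        nlinarith [sq_nonneg (G.card.choose (G.card / 2) : ℝ)]
      have h5 : (0 : ℝ) < √N₀ := Real.sqrt_pos.2 (by exact_mod_cast hN₀)
      calc _ ≤ ((2 ^ k * G.card.choose (G.card / 2) * 2 ^ (n - G.card) : ℕ) : ℝ) := by
            exact_mod_cast h1
        _ = 2 ^ k * (G.card.choose (G.card / 2) : ℝ) * 2 ^ (n - G.card) := by push_cast; ring
        _ ≤ 2 ^ k * (2 ^ G.card / √N₀) * 2 ^ (n - G.card) := by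
            gcongr
            rwa [le_div_iff₀ h5]
        _ = 2 ^ (G.card + (n - G.card)) * (2 ^ k / √N₀) := by rw [pow_add]; ring
        _ = 2 ^ n * (2 ^ k / √N₀) := by rw [Nat.add_sub_cancel' hGn]
        _ ≤ _ := by
            gcongr
            have : (0 : ℝ) ≤ 2 ^ N₀ * (1 / 2) ^ G.card := by positivity
            linarith
    · have h1 : ((Finset.univ.filter fun ξ => ‖elemSym k (choice (fun i => (q i).1)
            (fun i => (q i).2) ξ)‖ ≤ ‖c‖ ^ k * δ).card : ℝ) ≤ 2 ^ n := by
        have := Finset.card_le_univ (Finset.univ.filter fun ξ => ‖elemSym k (choice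
          (fun i => (q i).1) (fun i => (q i).2) ξ)‖ ≤ ‖c‖ ^ k * δ)
        rw [Fintype.card_finset, Fintype.card_fin] at this
        exact_mod_cast this
      have h2 : (1 : ℝ) ≤ 2 ^ N₀ * (1 / 2) ^ G.card := by
        have : (2 : ℝ) ^ G.card ≤ 2 ^ N₀ := pow_le_pow_right₀ (by norm_num) h.le
        rw [one_div, inv_pow, ← div_eq_mul_inv, le_div_iff₀ (by positivity)]
        linarith
      have h3 : (0 : ℝ) ≤ 2 ^ k / √N₀ := by positivity
      calc _ ≤ (2 : ℝ) ^ n * 1 := by linarith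
        _ ≤ _ := by gcongr; linarith
  have hprodint : Integrable (fun q : Fin n → ℂ × ℂ => ∏ i, φ (q i)) M := by
    refine Integrable.of_bound (C := 1) ?_ (ae_of_all _ fun q => ?_)
    · exact (Finset.measurable_prod _ fun i _ =>
        hφm.comp (measurable_pi_apply i)).aestronglyMeasurable
    · rw [Real.norm_of_nonneg (Finset.prod_nonneg fun i _ => hφ0 _)]
      exact Finset.prod_le_one (fun i _ => hφ0 _) fun i _ => hφ1 _
  have hindint : ∀ ξ : Finset (Fin n),
      Integrable ((sel ξ ⁻¹' S).indicator (fun _ => (1 : ℝ))) M := fun ξ =>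
    (integrable_const _).indicator ((hmp ξ).measurable hSm)
  have h := integral_mono (integrable_finsetSum Finset.univ fun ξ _ => hindint ξ)
    (((integrable_const (2 ^ k / √N₀)).add (hprodint.const_mul (2 ^ N₀))).const_mul (2 ^ n)) hpt
  rw [integral_finsetSum _ fun ξ _ => hindint ξ] at h
  simp only [Pi.add_apply] at h
  rw [integral_const_mul, integral_add (integrable_const _) (hprodint.const_mul _),
    integral_const_mul, integral_fintype_prod_eq_pow, hφint, Fintype.card_fin] at h
  have h6 : ∀ ξ : Finset (Fin n), ∫ q, (sel ξ ⁻¹' S).indicator (fun _ => (1 : ℝ)) q ∂M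
      = (Measure.pi fun _ : Fin n => ν).real S := by
    intro ξ
    rw [integral_indicator_const _ ((hmp ξ).measurable hSm), smul_eq_mul, mul_one,
      measureReal_def, (hmp ξ).measure_preimage hSm.nullMeasurableSet, measureReal_def]
  simp only [h6, Finset.sum_const, Finset.card_univ, Fintype.card_finset, Fintype.card_fin,
    nsmul_eq_mul, integral_const, probReal_univ, one_smul] at h
  push_cast at h
  exact le_of_mul_le_mul_left h (by positivity)

/-! ### Squares charged by a measure -/

/-- The half-open square with lower left corner `z` and side `s`. -/
def square (z : ℂ) (s : ℝ) : Set ℂ :=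
  {w | (z.re ≤ w.re ∧ w.re < z.re + s) ∧ z.im ≤ w.im ∧ w.im < z.im + s}

lemma measurableSet_square (z : ℂ) (s : ℝ) : MeasurableSet (square z s) := by
  have h1 := Complex.measurable_re
  have h2 := Complex.measurable_im
  exact ((measurableSet_le measurable_const h1).inter (measurableSet_lt h1 measurable_const)).inter
    ((measurableSet_le measurable_const h2).inter (measurableSet_lt h2 measurable_const))

lemma left_mem_square {z : ℂ} {s : ℝ} (hs : 0 < s) : z ∈ square z s :=
  ⟨⟨le_rfl, by linarith⟩, le_rfl, by linarith⟩

lemma norm_sub_le_of_mem_square {z w w' : ℂ} {s : ℝ} (hw : w ∈ square z s)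
    (hw' : w' ∈ square z s) : ‖w - w'‖ ≤ 2 * s := by
  obtain ⟨⟨h1, h2⟩, h3, h4⟩ := hw
  obtain ⟨⟨h1', h2'⟩, h3', h4'⟩ := hw'
  refine (Complex.norm_le_abs_re_add_abs_im _).trans ?_
  rw [Complex.sub_re, Complex.sub_im]
  have e1 : |w.re - w'.re| ≤ s := abs_le.2 ⟨by linarith, by linarith⟩
  have e2 : |w.im - w'.im| ≤ s := abs_le.2 ⟨by linarith, by linarith⟩
  linarith

/-- Halving a square `J` times, one can keep at least a proportion `4 ^ (-J)` of its mass. -/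
lemma exists_square_measureReal_ge (ν : Measure ℂ) [IsFiniteMeasure ν] (z : ℂ) {s : ℝ}
    (hs : 0 < s) (J : ℕ) :
    ∃ z', square z' (s / 2 ^ J) ⊆ square z s ∧
      ν.real (square z s) ≤ 4 ^ J * ν.real (square z' (s / 2 ^ J)) := by
  induction J with
  | zero => exact ⟨z, by simp, by simp⟩
  | succ J ih =>
    obtain ⟨z', hsub, hle⟩ := ih
    set t := s / 2 ^ (J + 1) with ht
    have ht0 : 0 < t := by positivity
    have hst : s / 2 ^ J = t + t := by rw [ht, pow_succ]; field_simp; norm_num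
    rw [hst] at hsub hle
    have hcover : square z' (t + t) ⊆ (square z' t ∪ square (z' + ⟨t, 0⟩) t) ∪
        (square (z' + ⟨0, t⟩) t ∪ square (z' + ⟨t, t⟩) t) := by
      rintro w ⟨⟨h1, h2⟩, h3, h4⟩
      simp only [square, Set.mem_union, Set.mem_ofPred_eq, Complex.add_re, Complex.add_im]
      rcases lt_or_ge w.re (z'.re + t) with h5 | h5 <;>
        rcases lt_or_ge w.im (z'.im + t) with h6 | h6
      · left; left; exact ⟨⟨h1, h5⟩, h3, h6⟩
      · right; left; exact ⟨⟨by linarith, by linarith⟩, by linarith, by linarith⟩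
      · left; right; exact ⟨⟨by linarith, by linarith⟩, by linarith, by linarith⟩
      · right; right; exact ⟨⟨by linarith, by linarith⟩, by linarith, by linarith⟩
    have hsubs : ∀ z'' : ℂ, (z'.re ≤ z''.re ∧ z''.re ≤ z'.re + t) →
        (z'.im ≤ z''.im ∧ z''.im ≤ z'.im + t) → square z'' t ⊆ square z s := by
      rintro z'' ⟨h1, h2⟩ ⟨h3, h4⟩ w ⟨⟨h5, h6⟩, h7, h8⟩
      exact hsub ⟨⟨by linarith, by linarith⟩, by linarith, by linarith⟩
    have hsum : ν.real (square z' (t + t)) ≤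
        (ν.real (square z' t) + ν.real (square (z' + ⟨t, 0⟩) t)) +
        (ν.real (square (z' + ⟨0, t⟩) t) + ν.real (square (z' + ⟨t, t⟩) t)) :=
      (measureReal_mono hcover).trans ((measureReal_union_le _ _).trans
        (add_le_add (measureReal_union_le _ _) (measureReal_union_le _ _)))
    by_contra! hcon
    have key : ∀ z'' : ℂ, (z'.re ≤ z''.re ∧ z''.re ≤ z'.re + t) →
        (z'.im ≤ z''.im ∧ z''.im ≤ z'.im + t) →
        4 * (4 ^ J * ν.real (square z'' t)) < ν.real (square z s) := by
      intro z'' h1 h2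
      have := hcon z'' (hsubs z'' h1 h2)
      rw [pow_succ] at this
      linarith
    have k1 := key z' ⟨le_rfl, by linarith⟩ ⟨le_rfl, by linarith⟩
    have k2 := key (z' + ⟨t, 0⟩) ⟨by simp [ht0.le], by simp⟩ ⟨by simp, by simp [ht0.le]⟩
    have k3 := key (z' + ⟨0, t⟩) ⟨by simp, by simp [ht0.le]⟩ ⟨by simp [ht0.le], by simp⟩
    have k4 := key (z' + ⟨t, t⟩) ⟨by simp [ht0.le], by simp⟩ ⟨by simp [ht0.le], by simp⟩
    have := mul_le_mul_of_nonneg_left hsum (by positivity : (0 : ℝ) ≤ 4 ^ J)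
    linarith

/-- A probability measure that is not a point mass has two points in its support. -/
lemma exists_ne_mem_support (ν : Measure ℂ) [IsProbabilityMeasure ν]
    (hν : ∀ x, ν ≠ Measure.dirac x) :
    ∃ a b, a ≠ b ∧ (∀ U ∈ 𝓝 a, 0 < ν U) ∧ ∀ U ∈ 𝓝 b, 0 < ν U := by
  have hne : ν.support.Nonempty := Measure.nonempty_support (IsProbabilityMeasure.ne_zero ν)
  obtain ⟨a, ha⟩ := hne
  have : ∃ b ∈ ν.support, a ≠ b := by
    by_contra! hcon
    have hsub : ({a} : Set ℂ)ᶜ ⊆ ν.supportᶜ := fun b hb hbs => hb (hcon b hbs).symm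
    have h0 : ν {a}ᶜ = 0 := measure_mono_null hsub Measure.measure_compl_support
    refine hν a ?_
    have hae : (id : ℂ → ℂ) =ᵐ[ν] fun _ => a := by
      rw [Filter.EventuallyEq, ae_iff]
      exact h0
    calc ν = ν.map id := Measure.map_id.symm
      _ = ν.map (fun _ => a) := Measure.map_congr hae
      _ = _ := by rw [Measure.map_const]; simp
  obtain ⟨b, hb, hab⟩ := this
  exact ⟨a, b, hab, (Measure.mem_support_iff_forall a).1 ha,
    (Measure.mem_support_iff_forall b).1 hb⟩

/-! ### Anti-concentration of elementary symmetric functions -/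

/-- A measure that is not a point mass charges two small squares, far apart relative to their
size, whose mass is bounded below by a power of their size. -/
lemma exists_separated_squares (ν : Measure ℂ) [IsProbabilityMeasure ν]
    (hν : ∀ x, ν ≠ Measure.dirac x) :
    ∃ κ > 0, ∃ m > 0, ∀ J : ℕ, ∃ A B : Set ℂ, ∃ c : ℂ, MeasurableSet A ∧ MeasurableSet B ∧
      A.Nonempty ∧ B.Nonempty ∧ 4 * κ ≤ ‖c‖ ∧ m ≤ 16 ^ J * (ν.real A * ν.real B) ∧
      ∀ x ∈ A, ∀ y ∈ B, ‖(x - y) / c - 1‖ ≤ 1 / 2 ^ J := by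
  obtain ⟨a, b, hab, ha, hb⟩ := exists_ne_mem_support ν hν
  have hd : 0 < ‖a - b‖ := norm_pos_iff.2 (sub_ne_zero.2 hab)
  set s := ‖a - b‖ / 8 with hs
  have hs0 : 0 < s := by positivity
  set o : ℂ := ⟨s / 2, s / 2⟩ with ho
  have hnhds : ∀ p : ℂ, square (p - o) s ∈ 𝓝 p := by
    intro p
    have h1 : ∀ᶠ w : ℂ in 𝓝 p, p.re - s / 2 < w.re ∧ w.re < p.re - s / 2 + s :=
      (Complex.continuous_re.tendsto p).eventually
        (Ioo_mem_nhds (by linarith) (by linarith))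
    have h2 : ∀ᶠ w : ℂ in 𝓝 p, p.im - s / 2 < w.im ∧ w.im < p.im - s / 2 + s :=
      (Complex.continuous_im.tendsto p).eventually
        (Ioo_mem_nhds (by linarith) (by linarith))
    filter_upwards [h1, h2] with w hw1 hw2
    exact ⟨⟨hw1.1.le, hw1.2⟩, hw2.1.le, hw2.2⟩
  have hpos : ∀ p : ℂ, (∀ U ∈ 𝓝 p, 0 < ν U) → 0 < ν.real (square (p - o) s) := fun p hp =>
    ENNReal.toReal_pos (hp _ (hnhds p)).ne' (measure_ne_top _ _)
  refine ⟨s, hs0, ν.real (square (a - o) s) * ν.real (square (b - o) s),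
    mul_pos (hpos a ha) (hpos b hb), fun J => ?_⟩
  obtain ⟨z₁, hz₁, hm₁⟩ := exists_square_measureReal_ge ν (a - o) hs0 J
  obtain ⟨z₂, hz₂, hm₂⟩ := exists_square_measureReal_ge ν (b - o) hs0 J
  have ht : 0 < s / 2 ^ J := by positivity
  have hc : 4 * s ≤ ‖z₁ - z₂‖ := by
    have h1 := norm_sub_le_of_mem_square (mem_of_mem_nhds (hnhds a)) (hz₁ (left_mem_square ht))
    have h2 := norm_sub_le_of_mem_square (hz₂ (left_mem_square ht)) (mem_of_mem_nhds (hnhds b))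
    have h3 : ‖a - b‖ ≤ ‖a - z₁‖ + ‖z₁ - z₂‖ + ‖z₂ - b‖ := by
      calc ‖a - b‖ = ‖(a - z₁) + (z₁ - z₂) + (z₂ - b)‖ := by ring_nf
        _ ≤ _ := norm_add₃_le
    have h4 : ‖a - b‖ = 8 * s := by rw [hs]; ring
    linarith
  refine ⟨square z₁ (s / 2 ^ J), square z₂ (s / 2 ^ J), z₁ - z₂, measurableSet_square _ _,
    measurableSet_square _ _, ⟨z₁, left_mem_square ht⟩, ⟨z₂, left_mem_square ht⟩, hc, ?_, ?_⟩
  · calc _ ≤ (4 ^ J * ν.real (square z₁ (s / 2 ^ J))) * (4 ^ J * ν.real (square z₂ (s / 2 ^ J))) := by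
          gcongr
      _ = (4 ^ J * 4 ^ J) * (ν.real (square z₁ (s / 2 ^ J)) * ν.real (square z₂ (s / 2 ^ J))) := by
          ring
      _ = _ := by rw [← mul_pow]; norm_num
  · intro x hx y hy
    have hc0 : 0 < ‖z₁ - z₂‖ := by linarith
    have hcne : z₁ - z₂ ≠ 0 := norm_pos_iff.1 hc0
    have e : (x - y) / (z₁ - z₂) - 1 = ((x - z₁) - (y - z₂)) / (z₁ - z₂) := by
      field_simp
      ring
    rw [e, norm_div, div_le_iff₀ hc0]
    have h1 := norm_sub_le_of_mem_square hx (left_mem_square ht)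
    have h2 := norm_sub_le_of_mem_square hy (left_mem_square ht)
    calc _ ≤ 2 * (s / 2 ^ J) + 2 * (s / 2 ^ J) := (norm_sub_le _ _).trans (add_le_add h1 h2)
      _ = 1 / 2 ^ J * (4 * s) := by ring
      _ ≤ _ := by gcongr

/-- **Anti-concentration.** If `k n = o(log n)`, the `k n`-th elementary symmetric function of
`n` i.i.d. variables whose law is not a point mass is at least exponential in `k n`, with
probability tending to `1`. -/
lemma exists_tendsto_measureReal_elemSym_le (ν : Measure ℂ) [IsProbabilityMeasure ν]
    (hν : ∀ x, ν ≠ Measure.dirac x) {k : ℕ → ℕ}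
    (hk : ∀ C : ℝ, 0 < C → Tendsto (fun n : ℕ => C ^ k n / (n : ℝ)) atTop (𝓝 0)) :
    ∃ κ > 0, Tendsto (fun n : ℕ => (Measure.pi fun _ : Fin n => ν).real
      {y | ‖elemSym (k n) y‖ ≤ κ ^ k n / 2}) atTop (𝓝 0) := by
  obtain ⟨κ, hκ, m, hm, hsq⟩ := exists_separated_squares ν hν
  refine ⟨κ, hκ, ?_⟩
  -- `q n` is a lower bound for the probability that an independent pair falls into `A × B`
  set q : ℕ → ℝ := fun n => m / (16 ^ 7 * (2 ^ 12) ^ k n) with hq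
  have hqn : Tendsto (fun n : ℕ => q n * n) atTop atTop := by
    have h1 := hk (2 ^ 12) (by positivity)
    have h2 : Tendsto (fun n : ℕ => ((2 ^ 12 : ℝ) ^ k n / n)⁻¹) atTop atTop := by
      refine Tendsto.inv_tendsto_nhdsGT_zero (tendsto_nhdsWithin_iff.2 ⟨h1, ?_⟩)
      filter_upwards [eventually_gt_atTop 0] with n hn
      have : (0 : ℝ) < n := by exact_mod_cast hn
      exact Set.mem_Ioi.2 (by positivity)
    have h3 := h2.const_mul_atTop (by positivity : 0 < m / 16 ^ 7)
    refine h3.congr fun n => ?_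
    rw [hq, inv_div]
    ring
  -- a fraction of the expected number of such pairs, so that fewer are exponentially unlikely
  set N₀ : ℕ → ℕ := fun n => ⌊q n * n / 4⌋₊ with hN₀
  have hbound : ∀ᶠ n : ℕ in atTop, (Measure.pi fun _ : Fin n => ν).real
      {y | ‖elemSym (k n) y‖ ≤ κ ^ k n / 2}
      ≤ √(8 / m * 16 ^ 7 * ((2 ^ 14) ^ k n / n)) + Real.exp (-(q n * n / 4)) := by
    filter_upwards [hqn.eventually_ge_atTop 8, eventually_gt_atTop 0] with n hn hn0
    have hn0' : (0 : ℝ) < n := by exact_mod_cast hn0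
    have hq0 : 0 < q n := by simp only [hq]; positivity
    -- the exponent is such that `2 ^ (3 * k + 7) = 16 * 8 ^ (k + 1)`, the precision that the
    -- small-ball estimate needs
    obtain ⟨A, B, c, hAm, hBm, hA, hB, hc, hmass, hAB⟩ := hsq (3 * k n + 7)
    have hc0 : 0 < ‖c‖ := by linarith
    have hfloor : (N₀ n : ℝ) ≤ q n * n / 4 := Nat.floor_le (by positivity)
    have hfloor' : q n * n / 8 ≤ N₀ n := by
      have := Nat.lt_floor_add_one (q n * n / 4)
      simp only [hN₀]
      linarith
    have hN₀pos : 0 < N₀ n := by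
      have : (0 : ℝ) < N₀ n := by linarith
      exact_mod_cast this
    have hp : q n ≤ ν.real A * ν.real B := by
      simp only [hq]
      rw [div_le_iff₀ (by positivity)]
      have e : (16 : ℝ) ^ (3 * k n + 7) = 16 ^ 7 * (2 ^ 12) ^ k n := by
        rw [pow_add, pow_mul]; norm_num; ring
      rw [e] at hmass
      linarith
    have hp1 : ν.real A * ν.real B ≤ 1 :=
      mul_le_one₀ measureReal_le_one measureReal_nonneg measureReal_le_one
    have key := measureReal_elemSym_le ν (n := n) (k := k n) hAm hBm (norm_pos_iff.1 hc0) hA hB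
      (fun x hx y hy => (hAB x hx y hy).trans (le_of_eq (by
        rw [pow_add, pow_mul, pow_add]; norm_num; ring)))
      (δ := (1 / 4) ^ k n / 2) (by
        rw [← mul_div_assoc, ← mul_pow]; norm_num) hN₀pos
    have hsub : {y : Fin n → ℂ | ‖elemSym (k n) y‖ ≤ κ ^ k n / 2} ⊆
        {y | ‖elemSym (k n) y‖ ≤ ‖c‖ ^ k n * ((1 / 4) ^ k n / 2)} := by
      intro y hy
      rw [Set.mem_ofPred_eq] at hy ⊢
      refine hy.trans ?_
      rw [← mul_div_assoc, ← mul_pow]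
      gcongr
      linarith
    refine (measureReal_mono hsub).trans (key.trans (add_le_add ?_ ?_))
    · rw [div_le_iff₀ (Real.sqrt_pos.2 (by exact_mod_cast hN₀pos)), ← Real.sqrt_mul (by positivity)]
      refine Real.le_sqrt_of_sq_le ?_
      calc ((2 : ℝ) ^ k n) ^ 2 = 8 / m * 16 ^ 7 * ((2 ^ 14) ^ k n / n) * (q n * n / 8) := by
            simp only [hq]
            rw [← pow_mul, mul_comm (k n) 2, pow_mul]
            have e : ((2 : ℝ) ^ 14) ^ k n = (2 ^ 2) ^ k n * (2 ^ 12) ^ k n := by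
              rw [← mul_pow]; norm_num
            rw [e]
            field_simp
        _ ≤ _ := by gcongr
    · have h1 : (2 : ℝ) ^ N₀ n ≤ Real.exp (N₀ n) := by
        rw [← Real.exp_one_pow]
        gcongr
        linarith [Real.add_one_le_exp (1 : ℝ)]
      have h2 : (1 - ν.real A * ν.real B / 2) ^ n ≤ Real.exp (-(q n * n / 2)) := by
        have h3 : 1 - ν.real A * ν.real B / 2 ≤ Real.exp (-(q n / 2)) :=
          le_trans (by linarith) (Real.one_sub_le_exp_neg _)
        calc _ ≤ Real.exp (-(q n / 2)) ^ n := pow_le_pow_left₀ (by linarith) h3 n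
          _ = _ := by rw [← Real.exp_nat_mul]; congr 1; ring
      calc _ ≤ Real.exp (N₀ n) * Real.exp (-(q n * n / 2)) :=
            mul_le_mul h1 h2 (pow_nonneg (by linarith) _) (Real.exp_nonneg _)
        _ = Real.exp (N₀ n + -(q n * n / 2)) := (Real.exp_add _ _).symm
        _ ≤ _ := Real.exp_le_exp.2 (by linarith)
  refine squeeze_zero' (Eventually.of_forall fun n => measureReal_nonneg) hbound ?_
  have h1 : Tendsto (fun n : ℕ => √(8 / m * 16 ^ 7 * ((2 ^ 14) ^ k n / n))) atTop (𝓝 0) := by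
    have := ((hk (2 ^ 14) (by positivity)).const_mul (8 / m * 16 ^ 7)).sqrt
    simpa using this
  have h2 : Tendsto (fun n : ℕ => Real.exp (-(q n * n / 4))) atTop (𝓝 0) :=
    Real.tendsto_exp_neg_atTop_nhds_zero.comp (hqn.atTop_div_const (by norm_num))
  simpa using h1.add h2

/-! ### Means of the logarithm over discs -/

/-- Integration over a disc, circle by circle. -/
lemma setIntegral_ball_eq_circleAverage {f : ℂ → ℝ} (hf : Measurable f) {c : ℂ} {R : ℝ}
    (hfi : IntegrableOn f (Metric.ball c R)) :
    ∫ z in Metric.ball c R, f z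
      = 2 * Real.pi * ∫ r in Set.Ioo 0 R, r * Real.circleAverage f c r := by
  set g : ℂ → ℝ := fun z => (Metric.ball c R).indicator f (c + z) with hg
  have hgm : Measurable g :=
    (hf.indicator measurableSet_ball).comp (measurable_const.add measurable_id)
  have hgi : Integrable g := by
    have := (integrable_indicator_iff measurableSet_ball).2 hfi
    exact this.comp_add_left c
  have h1 : ∫ z in Metric.ball c R, f z = ∫ z, g z := by
    rw [← integral_indicator measurableSet_ball]
    exact (integral_add_left_eq_self (fun z => (Metric.ball c R).indicator f z) c).symm
  set h : ℝ × ℝ → ℝ := fun p => p.1 • g (Complex.polarCoord.symm p) with hh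
  have hpm : Measurable fun p : ℝ × ℝ => Complex.polarCoord.symm p := by
    simp only [Complex.polarCoord_symm_apply]
    fun_prop
  have hhm : Measurable h := measurable_fst.smul (hgm.comp hpm)
  have htarget : polarCoord.target = Set.Ioi (0 : ℝ) ×ˢ Set.Ioo (-Real.pi) Real.pi := rfl
  have hhi : IntegrableOn h (Set.Ioi (0 : ℝ) ×ˢ Set.Ioo (-Real.pi) Real.pi) := by
    refine ⟨hhm.aestronglyMeasurable, ?_⟩
    have h2 := Complex.lintegral_comp_polarCoord_symm (fun z => ‖g z‖ₑ)
    rw [htarget] at h2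
    have h3 : ∫⁻ p in Set.Ioi (0 : ℝ) ×ˢ Set.Ioo (-Real.pi) Real.pi, ‖h p‖ₑ = ∫⁻ z, ‖g z‖ₑ := by
      rw [← h2]
      refine setLIntegral_congr_fun (measurableSet_Ioi.prod measurableSet_Ioo) fun p hp => ?_
      have hp0 : 0 < p.1 := hp.1
      simp only [hh, smul_eq_mul]
      rw [enorm_mul, Real.enorm_of_nonneg hp0.le]
    rw [hasFiniteIntegral_iff_enorm, h3]
    exact hgi.hasFiniteIntegral
  rw [h1, ← Complex.integral_comp_polarCoord_symm, htarget]
  change ∫ p in _, h p = _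
  rw [Measure.volume_eq_prod, setIntegral_prod _ (by rwa [← Measure.volume_eq_prod])]
  have h4 : ∀ r ∈ Set.Ioi (0 : ℝ), ∫ θ in Set.Ioo (-Real.pi) Real.pi, h (r, θ)
      = (Set.Ioo 0 R).indicator (fun r => 2 * Real.pi * (r * Real.circleAverage f c r)) r := by
    intro r hr
    have hr0 : 0 < r := hr
    have hmap : ∀ θ : ℝ, c + Complex.polarCoord.symm (r, θ) = circleMap c r θ := by
      intro θ
      rw [Complex.polarCoord_symm_apply, circleMap, Complex.exp_mul_I]
      push_cast
      ring
    have hnorm : ∀ θ : ℝ, ‖circleMap c r θ - c‖ = r := by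
      intro θ; simp [circleMap, abs_of_pos hr0]
    by_cases hrR : r < R
    · rw [Set.indicator_of_mem (Set.mem_Ioo.2 ⟨hr0, hrR⟩)]
      have e1 : ∀ θ : ℝ, h (r, θ) = r * f (circleMap c r θ) := by
        intro θ
        simp only [hh, hg, hmap, smul_eq_mul]
        rw [Set.indicator_of_mem (by rw [mem_ball_iff_norm, hnorm]; exact hrR)]
      simp only [e1]
      rw [integral_const_mul, ← integral_Ioc_eq_integral_Ioo,
        ← intervalIntegral.integral_of_le (by linarith [Real.pi_pos]),
        Real.circleAverage_eq_integral_add (-Real.pi),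
        intervalIntegral.integral_comp_add_right (fun θ => f (circleMap c r θ))]
      have e2 : (0 : ℝ) + -Real.pi = -Real.pi := by ring
      have e3 : 2 * Real.pi + -Real.pi = Real.pi := by ring
      rw [e2, e3, smul_eq_mul]
      field_simp
    · rw [Set.indicator_of_notMem (fun hm => hrR hm.2)]
      have e1 : ∀ θ : ℝ, h (r, θ) = 0 := by
        intro θ
        simp only [hh, hg, hmap, smul_eq_mul]
        rw [Set.indicator_of_notMem (by rw [mem_ball_iff_norm, hnorm]; exact hrR), mul_zero]
      simp [e1]
  rw [setIntegral_congr_fun measurableSet_Ioi h4, setIntegral_indicator measurableSet_Ioo,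
    integral_const_mul]
  congr 3
  ext r
  simp only [Set.mem_inter_iff, Set.mem_Ioi, Set.mem_Ioo]
  tauto

lemma integrableOn_inv_norm_sub (w : ℂ) (R : ℝ) :
    IntegrableOn (fun z => ‖z - w‖⁻¹) (Metric.ball w R) := by
  have h0 : IntegrableOn (fun z : ℂ => ‖z‖⁻¹) (Metric.ball 0 R) := by
    rw [integrableOn_fun_norm_addHaar volume (f := fun y => y⁻¹), Complex.finrank_real_complex]
    refine (integrableOn_const (C := (1 : ℝ)) (by simp)).congr_fun (fun y hy => ?_)
      measurableSet_Ioo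
    have : y ≠ 0 := hy.1.ne'
    simp [this]
  have h1 := ((integrable_indicator_iff measurableSet_ball).2 h0).comp_sub_right w
  refine (integrable_indicator_iff measurableSet_ball).1 (h1.congr (ae_of_all _ fun z => ?_))
  simp only [Set.indicator, mem_ball_iff_norm, sub_zero]

lemma integral_inv_norm_sub_ball (w : ℂ) {R : ℝ} (hR : 0 ≤ R) :
    ∫ z in Metric.ball w R, ‖z - w‖⁻¹ = 2 * Real.pi * R := by
  rw [setIntegral_ball_eq_circleAverage (by fun_prop) (integrableOn_inv_norm_sub w R)]
  congr 1
  have : ∀ r ∈ Set.Ioo 0 R, r * Real.circleAverage (fun z => ‖z - w‖⁻¹) w r = 1 := by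
    intro r hr
    have h1 : Real.circleAverage (fun z => ‖z - w‖⁻¹) w r = r⁻¹ := by
      rw [Real.circleAverage_congr_sphere (f₂ := fun _ => r⁻¹), Real.circleAverage_const]
      intro z hz
      rw [mem_sphere_iff_norm, abs_of_pos hr.1] at hz
      simp only [hz]
    rw [h1, mul_inv_cancel₀ hr.1.ne']
  rw [setIntegral_congr_fun measurableSet_Ioo this]
  simp [hR]

lemma integrableOn_inv_norm_sub_ball (w c : ℂ) (R : ℝ) :
    IntegrableOn (fun z => ‖z - w‖⁻¹) (Metric.ball c R) :=
  (integrableOn_inv_norm_sub w (R + dist c w)).mono_set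
    (Metric.ball_subset_ball' le_rfl)

lemma volume_real_ball (c : ℂ) {R : ℝ} (hR : 0 ≤ R) :
    volume.real (Metric.ball c R) = Real.pi * R ^ 2 := by
  rw [measureReal_def, Complex.volume_ball]
  simp [hR]
  ring

lemma setIntegral_inv_norm_sub_le (w c : ℂ) {R : ℝ} (hR : 0 ≤ R) :
    ∫ z in Metric.ball c R, ‖z - w‖⁻¹ ≤ 2 * Real.pi + Real.pi * R ^ 2 := by
  have h1 : IntegrableOn ((Metric.ball w 1).indicator fun z => ‖z - w‖⁻¹) (Metric.ball c R) :=
    ((integrable_indicator_iff measurableSet_ball).2 (integrableOn_inv_norm_sub w 1)).integrableOn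
  have h2 : IntegrableOn (fun _ : ℂ => (1 : ℝ)) (Metric.ball c R) :=
    integrableOn_const measure_ball_lt_top.ne
  calc _ ≤ ∫ z in Metric.ball c R, ((Metric.ball w 1).indicator (fun z => ‖z - w‖⁻¹) z + 1) := by
        refine setIntegral_mono (integrableOn_inv_norm_sub_ball w c R) (h1.add h2) fun z => ?_
        simp only [Set.indicator, mem_ball_iff_norm]
        split_ifs with h
        · linarith
        · rw [zero_add]; exact inv_le_one_of_one_le₀ (not_lt.1 h)
    _ = (∫ z in Metric.ball c R, (Metric.ball w 1).indicator (fun z => ‖z - w‖⁻¹) z)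
        + Real.pi * R ^ 2 := by
        rw [integral_add h1 h2]
        simp [volume_real_ball c hR]
    _ ≤ (∫ z, (Metric.ball w 1).indicator (fun z => ‖z - w‖⁻¹) z) + Real.pi * R ^ 2 := by
        refine add_le_add (setIntegral_le_integral
          ((integrable_indicator_iff measurableSet_ball).2 (integrableOn_inv_norm_sub w 1))
          (ae_of_all _ fun z => Set.indicator_nonneg (fun z _ => by positivity) z)) le_rfl
    _ = _ := by
        rw [integral_indicator measurableSet_ball, integral_inv_norm_sub_ball w zero_le_one, mul_one]

lemma abs_log_le_add_inv {t : ℝ} (ht : 0 ≤ t) : |Real.log t| ≤ t + t⁻¹ := by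
  rcases ht.eq_or_lt with rfl | ht
  · simp
  have h1 := Real.log_le_sub_one_of_pos ht
  have h2 := Real.log_le_sub_one_of_pos (inv_pos.2 ht)
  rw [Real.log_inv] at h2
  have h3 := inv_pos.2 ht
  exact abs_le.2 ⟨by linarith, by linarith⟩

lemma integrableOn_log_norm_sub (w c : ℂ) (R : ℝ) :
    IntegrableOn (fun z => Real.log ‖z - w‖) (Metric.ball c R) := by
  have h1 : IntegrableOn (fun z : ℂ => ‖z - w‖) (Metric.ball c R) :=
    ((by fun_prop : Continuous fun z : ℂ => ‖z - w‖).continuousOn.integrableOn_compact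
      (isCompact_closedBall c R)).mono_set Metric.ball_subset_closedBall
  refine Integrable.mono' (h1.add (integrableOn_inv_norm_sub_ball w c R))
    (by fun_prop : Measurable fun z : ℂ => Real.log ‖z - w‖).aestronglyMeasurable
    (ae_of_all _ fun z => ?_)
  exact abs_log_le_add_inv (norm_nonneg _)

/-- The mean of `log ‖· - w‖` over a disc of radius `R` whose centre is at distance `t` from
`w`, by Jensen's formula on each circle. -/
noncomputable def discMean (R t : ℝ) : ℝ := ∫ s in (0 : ℝ)..1, 2 * s * Real.log (max (R * s) t)

lemma integral_log_norm_sub_ball (w c : ℂ) {R : ℝ} (hR : 0 < R) :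
    ∫ z in Metric.ball c R, Real.log ‖z - w‖ = Real.pi * R ^ 2 * discMean R ‖c - w‖ := by
  rw [setIntegral_ball_eq_circleAverage (by fun_prop) (integrableOn_log_norm_sub w c R)]
  have h1 : ∀ r ∈ Set.Ioo 0 R, r * Real.circleAverage (fun z => Real.log ‖z - w‖) c r
      = r * Real.log (max r ‖c - w‖) := by
    intro r hr
    rw [circleAverage_log_norm_sub_const_eq_log_radius_add_posLog hr.1.ne']
    congr 1
    rcases le_total ‖c - w‖ r with h | h
    · rw [max_eq_left h, (Real.posLog_eq_zero_iff _).2, add_zero]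
      rw [abs_of_nonneg (mul_nonneg (inv_nonneg.2 hr.1.le) (norm_nonneg _))]
      exact inv_mul_le_one_of_le₀ h hr.1.le
    · have h0 : 0 < ‖c - w‖ := hr.1.trans_le h
      rw [max_eq_right h, Real.posLog_eq_log, Real.log_mul (inv_pos.2 hr.1).ne' h0.ne',
        Real.log_inv]
      · ring
      · rw [abs_of_nonneg (mul_nonneg (inv_nonneg.2 hr.1.le) (norm_nonneg _)),
          inv_mul_eq_div, one_le_div hr.1]
        exact h
  rw [setIntegral_congr_fun measurableSet_Ioo h1, ← integral_Ioc_eq_integral_Ioo,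
    ← intervalIntegral.integral_of_le hR.le, discMean]
  have h2 := intervalIntegral.integral_comp_mul_left (a := 0) (b := 1)
    (fun r => r * Real.log (max r ‖c - w‖)) hR.ne'
  rw [mul_zero, mul_one, smul_eq_mul] at h2
  have h3 : ∫ s in (0 : ℝ)..1, 2 * s * Real.log (max (R * s) ‖c - w‖)
      = 2 / R * ∫ s in (0 : ℝ)..1, R * s * Real.log (max (R * s) ‖c - w‖) := by
    rw [← intervalIntegral.integral_const_mul]
    congr 1
    funext s
    field_simp
  rw [h3, h2]
  field_simp

lemma intervalIntegrable_discMean (R : ℝ) {t : ℝ} (ht : 0 ≤ t) (hR : 0 < R) :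
    IntervalIntegrable (fun s => 2 * s * Real.log (max (R * s) t)) volume 0 1 := by
  rcases ht.eq_or_lt with rfl | ht
  · have h : Continuous fun s : ℝ => 2 / R * ((R * s) * Real.log (R * s)) :=
      continuous_const.mul (Real.continuous_mul_log.comp (continuous_const.mul continuous_id))
    refine (h.intervalIntegrable 0 1).congr fun s hs => ?_
    rw [Set.uIoc_of_le zero_le_one] at hs
    have : 0 ≤ R * s := mul_nonneg hR.le hs.1.le
    simp only [max_eq_left this]
    field_simp
  · refine Continuous.intervalIntegrable ?_ 0 1
    refine (by fun_prop : Continuous fun s : ℝ => 2 * s).mul (Continuous.log (by fun_prop) ?_)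
    exact fun s => (ht.trans_le (le_max_right _ _)).ne'

lemma log_le_discMean {R t : ℝ} (hR : 0 < R) (ht : 0 < t) : Real.log t ≤ discMean R t := by
  have h1 : ∫ s in (0 : ℝ)..1, 2 * s * Real.log t = Real.log t := by
    rw [intervalIntegral.integral_mul_const, intervalIntegral.integral_const_mul, integral_id]
    norm_num
  rw [← h1]
  refine intervalIntegral.integral_mono_on zero_le_one
    (Continuous.intervalIntegrable (by fun_prop) _ _) (intervalIntegrable_discMean R ht.le hR) ?_
  intro s hs
  have := hs.1
  gcongr
  exact le_max_right _ _

/-- The kernel `ρ / ‖z‖` on the disc of radius `ρ`, which dominates the positive part of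
`log (ρ / ‖z‖)`. -/
noncomputable def cut (ρ : ℝ) (z : ℂ) : ℝ := if ‖z‖ < ρ then ρ / ‖z‖ else 0

lemma discMean_le {R : ℝ} (hR : 0 < R) {z : ℂ} (hz : z ≠ 0) :
    discMean R ‖z‖ ≤ Real.log ‖z‖ + cut R z := by
  have ht : 0 < ‖z‖ := norm_pos_iff.2 hz
  have h1 : ∫ s in (0 : ℝ)..1, 2 * s * Real.log (max R ‖z‖) = Real.log (max R ‖z‖) := by
    rw [intervalIntegral.integral_mul_const, intervalIntegral.integral_const_mul, integral_id]
    norm_num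
  have h2 : discMean R ‖z‖ ≤ Real.log (max R ‖z‖) := by
    rw [← h1]
    refine intervalIntegral.integral_mono_on zero_le_one
      (intervalIntegrable_discMean R ht.le hR) (Continuous.intervalIntegrable (by fun_prop) _ _) ?_
    intro s hs
    have h3 := hs.1
    have h4 : R * s ≤ R := mul_le_of_le_one_right hR.le hs.2
    have : 0 < max (R * s) ‖z‖ := lt_max_of_lt_right ht
    gcongr
  refine h2.trans ?_
  rw [cut]
  split_ifs with h
  · rw [max_eq_left h.le]
    have h3 : Real.log R = Real.log ‖z‖ + Real.log (R / ‖z‖) := by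
      rw [Real.log_div hR.ne' ht.ne']; ring
    rw [h3]
    have := Real.log_le_sub_one_of_pos (div_pos hR ht)
    linarith
  · rw [max_eq_right (not_lt.1 h), add_zero]

/-! ### Radial bumps and potentials of polynomials -/

/-- A continuous bump, as a function of the distance `t` to its centre: the difference of the
means of `log ‖· - w‖` over concentric discs of radii `2 R` and `R`. It vanishes
for `t ≥ 2 R`. -/
noncomputable def bump (R t : ℝ) : ℝ :=
  ∫ s in (0 : ℝ)..1, 2 * s * (Real.log (max (2 * R * s) t) - Real.log (max (R * s) t))

lemma bump_eq {R t : ℝ} (hR : 0 < R) (ht : 0 ≤ t) :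
    bump R t = discMean (2 * R) t - discMean R t := by
  rw [discMean, discMean, bump, ← intervalIntegral.integral_sub
    (intervalIntegrable_discMean _ ht (by positivity)) (intervalIntegrable_discMean _ ht hR)]
  congr 1
  funext s
  ring

lemma bump_integrand_mem {R t s : ℝ} (hR : 0 < R) (hs : s ∈ Set.Ioc (0 : ℝ) 1) :
    0 ≤ 2 * s * (Real.log (max (2 * R * s) t) - Real.log (max (R * s) t)) ∧
      2 * s * (Real.log (max (2 * R * s) t) - Real.log (max (R * s) t)) ≤ 2 * s * Real.log 2 := by
  have h1 : 0 < R * s := mul_pos hR hs.1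
  have h2 : 0 < max (R * s) t := lt_max_of_lt_left h1
  have h3 : max (R * s) t ≤ max (2 * R * s) t := max_le_max (by linarith) le_rfl
  have h4 : max (2 * R * s) t ≤ 2 * max (R * s) t := by
    refine max_le ?_ ?_
    · linarith [le_max_left (R * s) t]
    · linarith [le_max_right (R * s) t]
  have h5 : Real.log (max (2 * R * s) t) ≤ Real.log 2 + Real.log (max (R * s) t) := by
    rw [← Real.log_mul (by norm_num) h2.ne']
    exact Real.log_le_log (h2.trans_le h3) h4
  have h6 := Real.log_le_log h2 h3
  have h7 := hs.1
  exact ⟨by nlinarith, by nlinarith⟩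

lemma bump_nonneg {R : ℝ} (hR : 0 < R) (t : ℝ) : 0 ≤ bump R t := by
  rw [bump, intervalIntegral.integral_of_le zero_le_one]
  exact setIntegral_nonneg measurableSet_Ioc fun s hs => (bump_integrand_mem hR hs).1

lemma continuous_bump {R : ℝ} (hR : 0 < R) : Continuous (bump R) := by
  refine intervalIntegral.continuous_of_dominated_interval (bound := fun s => 2 * s * Real.log 2)
    (fun t => ?_) (fun t => ae_of_all _ fun s hs => ?_)
    (Continuous.intervalIntegrable (by fun_prop) _ _) (ae_of_all _ fun s hs => ?_)
  · exact (by fun_prop : Measurable fun s : ℝ =>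
      2 * s * (Real.log (max (2 * R * s) t) - Real.log (max (R * s) t))).aestronglyMeasurable
  · rw [Set.uIoc_of_le zero_le_one] at hs
    obtain ⟨h1, h2⟩ := bump_integrand_mem (t := t) hR hs
    rwa [Real.norm_of_nonneg h1]
  · rw [Set.uIoc_of_le zero_le_one] at hs
    have h1 : 0 < R * s := mul_pos hR hs.1
    refine continuous_const.mul (Continuous.sub (Continuous.log (by fun_prop) fun t => ?_)
      (Continuous.log (by fun_prop) fun t => ?_))
    · exact (lt_max_of_lt_left (by linarith : 0 < 2 * R * s)).ne'
    · exact (lt_max_of_lt_left h1).ne'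

lemma bump_eq_zero {R t : ℝ} (hR : 0 < R) (ht : 2 * R ≤ t) : bump R t = 0 := by
  rw [bump, intervalIntegral.integral_of_le zero_le_one]
  refine setIntegral_eq_zero_of_forall_eq_zero fun s hs => ?_
  have h1 : R * s ≤ R := mul_le_of_le_one_right hR.le hs.2
  rw [max_eq_right (by linarith), max_eq_right (by linarith), sub_self, mul_zero]

lemma bump_zero_pos {R : ℝ} (hR : 0 < R) : 0 < bump R 0 := by
  have h1 : bump R 0 = ∫ s in (0 : ℝ)..1, 2 * s * Real.log 2 := by
    rw [bump, intervalIntegral.integral_of_le zero_le_one,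
      intervalIntegral.integral_of_le zero_le_one]
    refine setIntegral_congr_fun measurableSet_Ioc fun s hs => ?_
    have h1 : 0 < R * s := mul_pos hR hs.1
    rw [max_eq_left (by linarith), max_eq_left h1.le, mul_assoc 2 R s,
      Real.log_mul (by norm_num) h1.ne']
    ring
  rw [h1, intervalIntegral.integral_mul_const, intervalIntegral.integral_const_mul, integral_id]
  have := Real.log_pos (by norm_num : (1 : ℝ) < 2)
  norm_num
  exact this

lemma bump_le_log_two {R : ℝ} (hR : 0 < R) (t : ℝ) : bump R t ≤ Real.log 2 := by
  have h1 : ∫ s in (0 : ℝ)..1, 2 * s * Real.log 2 = Real.log 2 := by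
    rw [intervalIntegral.integral_mul_const, intervalIntegral.integral_const_mul, integral_id]
    norm_num
  rw [bump, ← h1, intervalIntegral.integral_of_le zero_le_one,
    intervalIntegral.integral_of_le zero_le_one]
  refine integral_mono_of_nonneg ?_ ?_ ?_
  · exact (ae_restrict_iff' measurableSet_Ioc).2
      (ae_of_all _ fun s hs => (bump_integrand_mem hR hs).1)
  · exact ((by fun_prop : Continuous fun s : ℝ => 2 * s * Real.log 2).intervalIntegrable 0 1).1
  · exact (ae_restrict_iff' measurableSet_Ioc).2
      (ae_of_all _ fun s hs => (bump_integrand_mem hR hs).2)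

lemma integral_sum_log_norm_sub_ball (s : Multiset ℂ) (c : ℂ) {R : ℝ} (hR : 0 < R) :
    IntegrableOn (fun z => (s.map fun w => Real.log ‖z - w‖).sum) (Metric.ball c R) ∧
    ∫ z in Metric.ball c R, (s.map fun w => Real.log ‖z - w‖).sum
      = Real.pi * R ^ 2 * (s.map fun w => discMean R ‖c - w‖).sum := by
  induction s using Multiset.induction with
  | empty => simp
  | cons w s ih =>
    simp only [Multiset.map_cons, Multiset.sum_cons]
    refine ⟨(integrableOn_log_norm_sub w c R).add ih.1, ?_⟩
    rw [integral_add (integrableOn_log_norm_sub w c R) ih.1, ih.2, integral_log_norm_sub_ball w c hR]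
    ring

lemma norm_eval_eq_prod_roots (Q : Polynomial ℂ) (z : ℂ) :
    ‖Q.eval z‖ = ‖Q.leadingCoeff‖ * (Q.roots.map fun w => ‖z - w‖).prod := by
  have h := (IsAlgClosed.splits Q).eval_eq_prod_roots z
  rw [h, norm_mul]
  congr 1
  have h2 := (map_multiset_prod (normHom (α := ℂ)) (Q.roots.map fun w => z - w))
  rw [Multiset.map_map] at h2
  exact h2

lemma log_norm_eval_eq {Q : Polynomial ℂ} {z : ℂ} (hz : Q.eval z ≠ 0) :
    Real.log ‖Q.eval z‖
      = Real.log ‖Q.leadingCoeff‖ + (Q.roots.map fun w => Real.log ‖z - w‖).sum := by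
  have hQ : Q ≠ 0 := by rintro rfl; simp at hz
  have hne : ∀ w ∈ Q.roots, ‖z - w‖ ≠ 0 := by
    intro w hw h
    rw [norm_eq_zero, sub_eq_zero] at h
    rw [h] at hz
    exact hz ((Polynomial.mem_roots hQ).1 hw)
  rw [norm_eval_eq_prod_roots, Real.log_mul (by simpa using hQ), Real.log_multiset_prod,
    Multiset.map_map]
  · rfl
  · intro x hx
    obtain ⟨w, hw, rfl⟩ := Multiset.mem_map.1 hx
    exact hne w hw
  · intro h
    obtain ⟨w, hw, h⟩ := Multiset.mem_map.1 (Multiset.prod_eq_zero_iff.1 h)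
    exact hne w hw h

lemma ae_eval_ne_zero {Q : Polynomial ℂ} (hQ : Q ≠ 0) : ∀ᵐ z : ℂ, Q.eval z ≠ 0 := by
  rw [ae_iff]
  simp only [not_not]
  refine Set.Finite.measure_zero ?_ _
  exact (Q.roots.toFinset.finite_toSet).subset fun z hz => by
    simpa [hQ] using hz

/-- The potential of a polynomial, averaged over a disc. -/
lemma integral_log_norm_eval_ball {Q : Polynomial ℂ} (hQ : Q ≠ 0) (c : ℂ) {R : ℝ} (hR : 0 < R) :
    IntegrableOn (fun z => Real.log ‖Q.eval z‖) (Metric.ball c R) ∧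
    ∫ z in Metric.ball c R, Real.log ‖Q.eval z‖ = Real.pi * R ^ 2 *
      (Real.log ‖Q.leadingCoeff‖ + (Q.roots.map fun w => discMean R ‖c - w‖).sum) := by
  obtain ⟨h1, h2⟩ := integral_sum_log_norm_sub_ball Q.roots c hR
  have h3 : IntegrableOn (fun _ : ℂ => Real.log ‖Q.leadingCoeff‖) (Metric.ball c R) :=
    integrableOn_const measure_ball_lt_top.ne
  have h4 : (fun z => Real.log ‖Q.eval z‖) =ᵐ[volume.restrict (Metric.ball c R)] fun z =>
      Real.log ‖Q.leadingCoeff‖ + (Q.roots.map fun w => Real.log ‖z - w‖).sum :=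
    ae_restrict_of_ae ((ae_eval_ne_zero hQ).mono fun z hz => log_norm_eval_eq hz)
  refine ⟨(h3.add h1).congr h4.symm, ?_⟩
  rw [integral_congr_ae h4, integral_add h3 h1, h2]
  simp [volume_real_ball c hR.le]
  ring

/-- The potential of a polynomial is subharmonic. -/
lemma log_norm_eval_le_integral_ball {Q : Polynomial ℂ} {c : ℂ} (hc : Q.eval c ≠ 0) {R : ℝ}
    (hR : 0 < R) :
    Real.pi * R ^ 2 * Real.log ‖Q.eval c‖ ≤ ∫ z in Metric.ball c R, Real.log ‖Q.eval z‖ := by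
  have hQ : Q ≠ 0 := by rintro rfl; simp at hc
  rw [(integral_log_norm_eval_ball hQ c hR).2, log_norm_eval_eq hc]
  gcongr with w hw
  refine Multiset.sum_map_le_sum_map _ _ fun w hw => log_le_discMean hR ?_
  rw [norm_pos_iff, sub_ne_zero]
  rintro rfl
  exact hc ((Polynomial.mem_roots hQ).1 hw)

/-- The potential of a polynomial exceeds its value at the centre of a disc, in the mean over the
disc, by at most the contribution of the roots in the disc. -/
lemma integral_ball_le_log_norm_eval {Q : Polynomial ℂ} {c : ℂ} (hc : Q.eval c ≠ 0) {R : ℝ}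
    (hR : 0 < R) :
    ∫ z in Metric.ball c R, Real.log ‖Q.eval z‖ ≤
      Real.pi * R ^ 2 * (Real.log ‖Q.eval c‖ + (Q.roots.map fun w => cut R (c - w)).sum) := by
  have hQ : Q ≠ 0 := by rintro rfl; simp at hc
  rw [(integral_log_norm_eval_ball hQ c hR).2, log_norm_eval_eq hc, add_assoc,
    ← Multiset.sum_map_add]
  gcongr
  refine Multiset.sum_map_le_sum_map _ _ fun w hw => discMean_le hR ?_
  rw [sub_ne_zero]
  rintro rfl
  exact hc ((Polynomial.mem_roots hQ).1 hw)

/-! ### The ratio of a polynomial to its derivative -/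

section

lemma roots_rootPoly (x : ℕ → ℂ) (n : ℕ) :
    (rootPoly x n).roots = (Finset.range n).val.map x := by
  have : rootPoly x n
      = (((Finset.range n).val.map x).map fun a => Polynomial.X - Polynomial.C a).prod := by
    rw [Multiset.map_map]; rfl
  rw [this, Polynomial.roots_multiset_prod_X_sub_C]

lemma monic_rootPoly (x : ℕ → ℂ) (n : ℕ) : (rootPoly x n).Monic :=
  Polynomial.monic_prod_of_monic _ _ fun _ _ => Polynomial.monic_X_sub_C _

lemma natDegree_rootPoly (x : ℕ → ℂ) (n : ℕ) : (rootPoly x n).natDegree = n := by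
  rw [(IsAlgClosed.splits _).natDegree_eq_card_roots, roots_rootPoly]
  simp

lemma eval_rootPoly (x : ℕ → ℂ) (n : ℕ) (z : ℂ) :
    (rootPoly x n).eval z = ∏ i ∈ Finset.range n, (z - x i) := by
  simp [rootPoly, Polynomial.eval_prod]

lemma sum_roots_rootPoly (x : ℕ → ℂ) (n : ℕ) (f : ℂ → ℝ) :
    ((rootPoly x n).roots.map f).sum = ∑ i ∈ Finset.range n, f (x i) := by
  rw [roots_rootPoly, Multiset.map_map]; rfl

lemma iterate_derivative_coeff_ne_zero (x : ℕ → ℂ) {n k : ℕ} (hk : k ≤ n) :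
    (Polynomial.derivative^[k] (rootPoly x n)).coeff (n - k) ≠ 0 := by
  have h := monic_rootPoly x n
  rw [Polynomial.Monic, Polynomial.leadingCoeff, natDegree_rootPoly] at h
  rw [Polynomial.coeff_iterate_derivative, Nat.sub_add_cancel hk, h, nsmul_eq_mul, mul_one]
  exact_mod_cast fun h => (Nat.descFactorial_eq_zero_iff_lt.1 h).not_ge hk

lemma iterate_derivative_ne_zero (x : ℕ → ℂ) {n k : ℕ} (hk : k ≤ n) :
    Polynomial.derivative^[k] (rootPoly x n) ≠ 0 := fun h =>
  iterate_derivative_coeff_ne_zero x hk (by rw [h, Polynomial.coeff_zero])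

lemma card_roots_iterate_derivative (x : ℕ → ℂ) {n k : ℕ} (hk : k ≤ n) :
    (Polynomial.derivative^[k] (rootPoly x n)).roots.card = n - k := by
  rw [← (IsAlgClosed.splits _).natDegree_eq_card_roots]
  refine le_antisymm ?_ (Polynomial.le_natDegree_of_ne_zero (iterate_derivative_coeff_ne_zero x hk))
  have := Polynomial.natDegree_iterate_derivative (rootPoly x n) k
  rwa [natDegree_rootPoly] at this

/-- Taylor expansion at `z` of a polynomial in terms of the inverse distances to its roots. -/
lemma eval_iterate_derivative_rootPoly (x : ℕ → ℂ) {n : ℕ} (k : ℕ) {z : ℂ}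
    (hz : (rootPoly x n).eval z ≠ 0) :
    (Polynomial.derivative^[k] (rootPoly x n)).eval z
      = (rootPoly x n).eval z * (k.factorial * elemSym k fun i : Fin n => (z - x i)⁻¹) := by
  have hne : ∀ i < n, z - x i ≠ 0 := by
    rw [eval_rootPoly, Finset.prod_ne_zero_iff] at hz
    exact fun i hi => hz i (Finset.mem_range.2 hi)
  have h1 : Polynomial.taylor z (rootPoly x n) = Polynomial.C ((rootPoly x n).eval z) *
      ∏ i : Fin n, (1 + Polynomial.C ((z - x i)⁻¹) * Polynomial.X) := by
    rw [eval_rootPoly, map_prod, Fin.prod_univ_eq_prod_range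
      (fun i => 1 + Polynomial.C ((z - x i)⁻¹) * Polynomial.X) n, ← Finset.prod_mul_distrib]
    change Polynomial.taylorAlgHom z (rootPoly x n) = _
    rw [rootPoly, map_prod]
    refine Finset.prod_congr rfl fun i hi => ?_
    change Polynomial.taylor z (Polynomial.X - Polynomial.C (x i)) = _
    rw [map_sub, Polynomial.taylor_X, Polynomial.taylor_C, mul_add, mul_one, ← mul_assoc,
      ← map_mul, mul_inv_cancel₀ (hne i (Finset.mem_range.1 hi)), map_one, one_mul, map_sub]
    ring
  have h2 : (Polynomial.hasseDeriv k (rootPoly x n)).eval z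
      = (rootPoly x n).eval z * elemSym k fun i : Fin n => (z - x i)⁻¹ := by
    rw [← Polynomial.taylor_coeff, h1, Polynomial.coeff_C_mul, elemSym]
  rw [← Polynomial.factorial_smul_hasseDeriv, LinearMap.smul_apply, Polynomial.eval_smul, h2,
    nsmul_eq_mul]
  ring

lemma pow_succ_add_le {a b : ℝ} (ha : 0 ≤ a) (hb : 0 ≤ b) (k : ℕ) :
    a ^ (k + 1) + (k + 1) * b * a ^ k ≤ (a + b) ^ (k + 1) := by
  induction k with
  | zero => simp
  | succ k ih =>
    have h1 : (a + b) * (a ^ (k + 1) + (k + 1) * b * a ^ k) ≤ (a + b) * (a + b) ^ (k + 1) := by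
      gcongr
    have h2 : 0 ≤ (k + 1) * b * b * a ^ k := by positivity
    push_cast
    calc _ ≤ (a + b) * (a ^ (k + 1) + (k + 1) * b * a ^ k) := by
          rw [← sub_nonneg]
          refine h2.trans_eq ?_
          ring
      _ ≤ _ := h1
      _ = _ := by ring

lemma factorial_mul_norm_elemSym_le {ι : Type*} [Fintype ι] (k : ℕ) (y : ι → ℂ) :
    k.factorial * ‖elemSym k y‖ ≤ (∑ i, ‖y i‖) ^ k := by
  classical
  rw [elemSym]
  generalize (Finset.univ : Finset ι) = s
  induction s using Finset.induction_on generalizing k with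
  | empty =>
    rcases k with _ | k
    · simp
    · simp [Polynomial.coeff_one]
  | insert j s hj ih =>
    rw [Finset.prod_insert hj, Finset.sum_insert hj]
    rcases k with _ | k
    · simpa [add_mul] using ih 0
    · have e : ((1 + Polynomial.C (y j) * Polynomial.X) *
          ∏ i ∈ s, (1 + Polynomial.C (y i) * Polynomial.X)).coeff (k + 1)
          = (∏ i ∈ s, (1 + Polynomial.C (y i) * Polynomial.X)).coeff (k + 1)
            + y j * (∏ i ∈ s, (1 + Polynomial.C (y i) * Polynomial.X)).coeff k := by
        rw [add_mul, one_mul, Polynomial.coeff_add, mul_assoc, Polynomial.coeff_C_mul,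
          Polynomial.coeff_X_mul]
      rw [e]
      set p := ∏ i ∈ s, (1 + Polynomial.C (y i) * Polynomial.X)
      set S := ∑ i ∈ s, ‖y i‖ with hS
      have hS0 : 0 ≤ S := Finset.sum_nonneg fun i _ => norm_nonneg _
      have h1 := ih (k + 1)
      have h2 := ih k
      calc ((k + 1).factorial : ℝ) * ‖p.coeff (k + 1) + y j * p.coeff k‖
          ≤ (k + 1).factorial * (‖p.coeff (k + 1)‖ + ‖y j‖ * ‖p.coeff k‖) := by
            gcongr
            exact (norm_add_le _ _).trans_eq (by rw [norm_mul])
        _ = (k + 1).factorial * ‖p.coeff (k + 1)‖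
            + (k + 1) * ‖y j‖ * (k.factorial * ‖p.coeff k‖) := by
            rw [Nat.factorial_succ]; push_cast; ring
        _ ≤ S ^ (k + 1) + (k + 1) * ‖y j‖ * S ^ k := by gcongr
        _ ≤ (S + ‖y j‖) ^ (k + 1) := pow_succ_add_le hS0 (norm_nonneg _) k
        _ = _ := by rw [add_comm]

/-- The logarithm of `|P_n^{(k)} / P_n|`. -/
noncomputable def logRatio (x : ℕ → ℂ) (n k : ℕ) (z : ℂ) : ℝ :=
  Real.log ‖(Polynomial.derivative^[k] (rootPoly x n)).eval z‖ - Real.log ‖(rootPoly x n).eval z‖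

variable {x : ℕ → ℂ} {n k : ℕ}

lemma integrableOn_logRatio (hk : k ≤ n) (c : ℂ) {R : ℝ} (hR : 0 < R) :
    IntegrableOn (logRatio x n k) (Metric.ball c R) :=
  (integral_log_norm_eval_ball (iterate_derivative_ne_zero x hk) c hR).1.sub
    (integral_log_norm_eval_ball (monic_rootPoly x n).ne_zero c hR).1

/-- The positive part of `log |P_n^{(k)} / P_n|` is at most of order `k log n`, in the mean. -/
lemma setIntegral_max_logRatio_le (hk : k ≤ n) (c : ℂ) {R : ℝ} (hR : 0 < R) :
    ∫ z in Metric.ball c R, max (logRatio x n k z) 0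
      ≤ k * ((2 * Real.pi + Real.pi * R ^ 2) * (Real.log (1 + n) + 1)) := by
  set S : ℂ → ℝ := fun z => ∑ i ∈ Finset.range n, ‖z - x i‖⁻¹ with hS
  have hS0 : ∀ z, 0 ≤ S z := fun z => Finset.sum_nonneg fun i _ => by positivity
  have hSi : IntegrableOn S (Metric.ball c R) :=
    integrable_finsetSum _ fun i _ => integrableOn_inv_norm_sub_ball (x i) c R
  have hn : (0 : ℝ) < 1 + n := by positivity
  have hlog : 0 ≤ Real.log (1 + n) := Real.log_nonneg (by linarith [Nat.cast_nonneg (α := ℝ) n])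
  have hci : IntegrableOn (fun _ : ℂ => Real.log (1 + n)) (Metric.ball c R) :=
    integrableOn_const measure_ball_lt_top.ne
  have hae : ∀ᵐ z ∂volume.restrict (Metric.ball c R), max (logRatio x n k z) 0
      ≤ k * (Real.log (1 + n) + (1 + n : ℝ)⁻¹ * S z) := by
    refine ae_restrict_of_ae ?_
    filter_upwards [ae_eval_ne_zero (iterate_derivative_ne_zero x hk),
      ae_eval_ne_zero (monic_rootPoly x n).ne_zero] with z hz1 hz2
    have hSz := hS0 z
    refine max_le ?_ (by positivity)
    have h1 : ‖(Polynomial.derivative^[k] (rootPoly x n)).eval z‖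
        ≤ ‖(rootPoly x n).eval z‖ * (1 + S z) ^ k := by
      rw [eval_iterate_derivative_rootPoly x k hz2, norm_mul, norm_mul]
      gcongr
      rw [Complex.norm_natCast]
      refine (factorial_mul_norm_elemSym_le k _).trans ?_
      have e : ∑ i : Fin n, ‖(z - x i)⁻¹‖ = S z := by
        simp only [norm_inv]
        exact Fin.sum_univ_eq_sum_range (fun i => ‖z - x i‖⁻¹) n
      rw [e]
      gcongr
      linarith
    have h2 : logRatio x n k z ≤ k * Real.log (1 + S z) := by
      have h3 := Real.log_le_log (norm_pos_iff.2 hz1) h1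
      rw [Real.log_mul (norm_pos_iff.2 hz2).ne' (by positivity), Real.log_pow] at h3
      rw [logRatio]
      linarith
    refine h2.trans ?_
    gcongr
    have h4 : Real.log (1 + S z) = Real.log (1 + n) + Real.log ((1 + S z) / (1 + n)) := by
      rw [Real.log_div (by positivity) hn.ne']; ring
    rw [h4]
    gcongr
    refine (Real.log_le_sub_one_of_pos (by positivity)).trans ?_
    rw [add_div, ← div_eq_inv_mul]
    have : 1 / (1 + (n : ℝ)) ≤ 1 := by
      rw [div_le_one hn]; linarith [Nat.cast_nonneg (α := ℝ) n]
    linarith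
  have hint : IntegrableOn (fun z => (k : ℝ) * (Real.log (1 + n) + (1 + n : ℝ)⁻¹ * S z))
      (Metric.ball c R) := (hci.add (hSi.const_mul _)).const_mul _
  refine (integral_mono_ae (integrableOn_logRatio hk c hR).pos_part hint hae).trans ?_
  rw [integral_const_mul, integral_add hci (hSi.const_mul _), integral_const_mul,
    integral_finsetSum _ fun i _ => integrableOn_inv_norm_sub_ball (x i) c R]
  gcongr
  have h5 : ∑ i ∈ Finset.range n, ∫ z in Metric.ball c R, ‖z - x i‖⁻¹
      ≤ n * (2 * Real.pi + Real.pi * R ^ 2) := by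
    refine (Finset.sum_le_sum fun i _ => setIntegral_inv_norm_sub_le (x i) c hR.le).trans_eq ?_
    simp
    ring
  have h6 : (1 + n : ℝ)⁻¹ * (n * (2 * Real.pi + Real.pi * R ^ 2))
      ≤ 2 * Real.pi + Real.pi * R ^ 2 := by
    rw [inv_mul_le_iff₀ hn]
    have : 0 ≤ 2 * Real.pi + Real.pi * R ^ 2 := by positivity
    linarith
  have h7 : (1 + n : ℝ)⁻¹ * ∑ i ∈ Finset.range n, ∫ z in Metric.ball c R, ‖z - x i‖⁻¹
      ≤ 2 * Real.pi + Real.pi * R ^ 2 := le_trans (by gcongr) h6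
  have h8 : ∫ z in Metric.ball c R, Real.log (1 + n) = Real.pi * R ^ 2 * Real.log (1 + n) := by
    simp [volume_real_ball c hR.le]
  rw [h8]
  have := mul_nonneg Real.pi_pos.le hlog
  nlinarith

/-- A lower bound for `|P_n^{(k)} / P_n|` at the centre of a disc controls its logarithm in the
mean over the disc: the potential of `P_n^{(k)}` is subharmonic, and that of `P_n` is nearly
constant on the disc if there are few roots in it. -/
lemma setIntegral_abs_logRatio_le (hk : k ≤ n) {c : ℂ} {R : ℝ} (hR : 0 < R)
    (hP : (rootPoly x n).eval c ≠ 0) {a : ℝ} (ha : 0 < a)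
    (hlow : a ≤ ‖elemSym k fun i : Fin n => (c - x i)⁻¹‖) :
    ∫ z in Metric.ball c R, |logRatio x n k z|
      ≤ 2 * (k * ((2 * Real.pi + Real.pi * R ^ 2) * (Real.log (1 + n) + 1)))
        + Real.pi * R ^ 2 * (-Real.log a + ∑ i ∈ Finset.range n, cut R (c - x i)) := by
  have hfi := integrableOn_logRatio (x := x) hk c hR
  have e : ∀ z, |logRatio x n k z| = 2 * max (logRatio x n k z) 0 - logRatio x n k z := by
    intro z
    rcases le_total 0 (logRatio x n k z) with h | h
    · rw [abs_of_nonneg h, max_eq_left h]; ring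
    · rw [abs_of_nonpos h, max_eq_right h]; ring
  simp only [e]
  rw [integral_sub (hfi.pos_part.const_mul 2) hfi, integral_const_mul]
  have h1 := setIntegral_max_logRatio_le (x := x) hk c hR
  have hQP := eval_iterate_derivative_rootPoly x k hP
  have hE : elemSym k (fun i : Fin n => (c - x i)⁻¹) ≠ 0 := by
    rw [← norm_pos_iff]; exact ha.trans_le hlow
  have hfact : (1 : ℝ) ≤ k.factorial := by exact_mod_cast k.factorial_pos
  have hQ : (Polynomial.derivative^[k] (rootPoly x n)).eval c ≠ 0 := by
    rw [hQP]
    exact mul_ne_zero hP (mul_ne_zero (by exact_mod_cast k.factorial_ne_zero) hE)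
  have h2 := log_norm_eval_le_integral_ball hQ hR
  have h3 := integral_ball_le_log_norm_eval hP hR
  rw [sum_roots_rootPoly x n fun w => cut R (c - w)] at h3
  have h4 : Real.log a + Real.log ‖(rootPoly x n).eval c‖
      ≤ Real.log ‖(Polynomial.derivative^[k] (rootPoly x n)).eval c‖ := by
    rw [← Real.log_mul ha.ne' (norm_pos_iff.2 hP).ne', hQP, norm_mul, norm_mul,
      Complex.norm_natCast]
    have hP' := norm_pos_iff.2 hP
    refine Real.log_le_log (by positivity) ?_
    rw [mul_comm a]
    gcongr
    nlinarith
  have h5 : ∫ z in Metric.ball c R, logRatio x n k z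
      = (∫ z in Metric.ball c R, Real.log ‖(Polynomial.derivative^[k] (rootPoly x n)).eval z‖)
        - ∫ z in Metric.ball c R, Real.log ‖(rootPoly x n).eval z‖ :=
    integral_sub (integral_log_norm_eval_ball (iterate_derivative_ne_zero x hk) c hR).1
      (integral_log_norm_eval_ball (monic_rootPoly x n).ne_zero c hR).1
  have h6 : 0 < Real.pi * R ^ 2 := by positivity
  have h7 := mul_le_mul_of_nonneg_left h4 h6.le
  rw [h5]
  linarith

/-- The bump statistics of the roots of `P_n^{(k)}` and of `P_n` differ by at most the `L¹` norm
of `log |P_n^{(k)} / P_n|` near the bump. -/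
lemma abs_sum_bump_sub_le (hk : k ≤ n) (c : ℂ) {R : ℝ} (hR : 0 < R) :
    |((Polynomial.derivative^[k] (rootPoly x n)).roots.map fun w => bump R ‖c - w‖).sum
        - ∑ i ∈ Finset.range n, bump R ‖c - x i‖|
      ≤ 2 / (Real.pi * R ^ 2) * ∫ z in Metric.ball c (2 * R), |logRatio x n k z| := by
  set Q := Polynomial.derivative^[k] (rootPoly x n) with hQ
  have hQ0 : Q ≠ 0 := iterate_derivative_ne_zero x hk
  have hP0 : rootPoly x n ≠ 0 := (monic_rootPoly x n).ne_zero
  have hR2 : 0 < 2 * R := by positivity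
  have hfi2 := integrableOn_logRatio (x := x) hk c hR2
  have key : ∀ r : ℝ, 0 < r → (Real.pi * r ^ 2)⁻¹ * ∫ z in Metric.ball c r, logRatio x n k z
      = Real.log ‖Q.leadingCoeff‖ + (Q.roots.map fun w => discMean r ‖c - w‖).sum
        - (Real.log ‖(rootPoly x n).leadingCoeff‖
          + ∑ i ∈ Finset.range n, discMean r ‖c - x i‖) := by
    intro r hr
    have h5 : ∫ z in Metric.ball c r, logRatio x n k z
        = (∫ z in Metric.ball c r, Real.log ‖Q.eval z‖)
          - ∫ z in Metric.ball c r, Real.log ‖(rootPoly x n).eval z‖ :=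
      integral_sub (integral_log_norm_eval_ball hQ0 c hr).1
        (integral_log_norm_eval_ball hP0 c hr).1
    rw [h5, (integral_log_norm_eval_ball hQ0 c hr).2, (integral_log_norm_eval_ball hP0 c hr).2,
      sum_roots_rootPoly x n fun w => discMean r ‖c - w‖]
    have := Real.pi_pos
    field_simp
  have h1 : (Q.roots.map fun w => bump R ‖c - w‖).sum - ∑ i ∈ Finset.range n, bump R ‖c - x i‖
      = (Real.pi * (2 * R) ^ 2)⁻¹ * (∫ z in Metric.ball c (2 * R), logRatio x n k z)
        - (Real.pi * R ^ 2)⁻¹ * ∫ z in Metric.ball c R, logRatio x n k z := by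
    rw [key _ hR2, key _ hR]
    simp only [bump_eq hR (norm_nonneg _), Multiset.sum_map_sub, Finset.sum_sub_distrib]
    ring
  rw [h1]
  set I := ∫ z in Metric.ball c (2 * R), |logRatio x n k z| with hI
  have hI0 : 0 ≤ I := integral_nonneg fun z => abs_nonneg _
  have h2 : |∫ z in Metric.ball c (2 * R), logRatio x n k z| ≤ I := abs_integral_le_integral_abs
  have h3 : |∫ z in Metric.ball c R, logRatio x n k z| ≤ I :=
    abs_integral_le_integral_abs.trans (setIntegral_mono_set hfi2.abs
      (ae_of_all _ fun z => abs_nonneg _)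
      (Metric.ball_subset_ball (by linarith)).eventuallyLE)
  have h4 : 0 < (Real.pi * R ^ 2)⁻¹ := by positivity
  have h6 : (Real.pi * (2 * R) ^ 2)⁻¹ ≤ (Real.pi * R ^ 2)⁻¹ := by
    gcongr
    linarith
  have h7 : 0 < (Real.pi * (2 * R) ^ 2)⁻¹ := by positivity
  calc _ ≤ (Real.pi * (2 * R) ^ 2)⁻¹ * |∫ z in Metric.ball c (2 * R), logRatio x n k z|
        + (Real.pi * R ^ 2)⁻¹ * |∫ z in Metric.ball c R, logRatio x n k z| := by
        refine (abs_sub _ _).trans_eq ?_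
        rw [abs_mul, abs_mul, abs_of_pos h4, abs_of_pos h7]
    _ ≤ (Real.pi * R ^ 2)⁻¹ * I + (Real.pi * R ^ 2)⁻¹ * I := by gcongr
    _ = _ := by ring

end

/-! ### Covering a disc by discs with good centres -/

lemma volume_square (z : ℂ) {s : ℝ} (hs : 0 ≤ s) :
    volume (square z s) = ENNReal.ofReal (s ^ 2) := by
  have h1 : square z s = Complex.measurableEquivRealProd ⁻¹'
      (Set.Ico z.re (z.re + s) ×ˢ Set.Ico z.im (z.im + s)) := rfl
  rw [h1, Complex.volume_preserving_equiv_real_prod.measure_preimage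
    (measurableSet_Ico.prod measurableSet_Ico).nullMeasurableSet, Measure.volume_eq_prod,
    Measure.prod_prod, Real.volume_Ico, Real.volume_Ico, ← ENNReal.ofReal_mul (by linarith)]
  congr 1
  ring

/-- The squares of a square lattice with mesh `s`. -/
def cell (s : ℝ) (p : ℤ × ℤ) : Set ℂ := square ⟨s * p.1, s * p.2⟩ s

lemma mem_cell_iff {s : ℝ} (hs : 0 < s) {p : ℤ × ℤ} {w : ℂ} :
    w ∈ cell s p ↔ ⌊w.re / s⌋ = p.1 ∧ ⌊w.im / s⌋ = p.2 := by
  rw [Int.floor_eq_iff, Int.floor_eq_iff, le_div_iff₀ hs, div_lt_iff₀ hs, le_div_iff₀ hs,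
    div_lt_iff₀ hs]
  simp only [cell, square, Set.mem_ofPred_eq, add_mul, one_mul, mul_comm s]

lemma measurable_cut (ρ : ℝ) : Measurable (cut ρ) :=
  Measurable.ite (measurableSet_lt measurable_norm measurable_const) (by fun_prop) measurable_const

lemma cut_nonneg {ρ : ℝ} (hρ : 0 ≤ ρ) (z : ℂ) : 0 ≤ cut ρ z := by
  rw [cut]; split_ifs <;> positivity

lemma lintegral_cut {ρ : ℝ} (hρ : 0 ≤ ρ) (x : ℂ) :
    ∫⁻ z, ENNReal.ofReal (cut ρ (z - x)) = ENNReal.ofReal (2 * Real.pi * ρ ^ 2) := by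
  have h1 : (fun z => cut ρ (z - x)) = (Metric.ball x ρ).indicator fun z => ρ * ‖z - x‖⁻¹ := by
    funext z
    simp only [cut, Set.indicator, mem_ball_iff_norm, div_eq_mul_inv]
  have h2 : Integrable fun z => cut ρ (z - x) := by
    rw [h1, integrable_indicator_iff measurableSet_ball]
    exact (integrableOn_inv_norm_sub x ρ).const_mul ρ
  rw [← ofReal_integral_eq_lintegral_ofReal h2 (ae_of_all _ fun z => cut_nonneg hρ _), h1,
    integral_indicator measurableSet_ball, integral_const_mul, integral_inv_norm_sub_ball x hρ]
  congr 1
  ring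

/-- A disc is covered by finitely many discs of radius `ρ` whose centres avoid a given null set
and do not see too much of the measure `μ` on the scale `ρ`, in total. The centres are chosen in
the cells of a lattice, by the first moment method. -/
lemma exists_finset_cover (μ : Measure ℂ) [IsProbabilityMeasure μ] {N : Set ℂ}
    (hN : volume N = 0) (z₀ : ℂ) (R : ℝ) {ρ : ℝ} (hρ : 0 < ρ) :
    ∃ (I : Finset (ℤ × ℤ)) (ζ : ℤ × ℤ → ℂ), (∀ p, ζ p ∉ N) ∧
      Metric.ball z₀ R ⊆ ⋃ p ∈ I, Metric.ball (ζ p) ρ ∧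
      ∑ p ∈ I, ∫⁻ x, ENNReal.ofReal (cut ρ (ζ p - x)) ∂μ ≤ ENNReal.ofReal (32 * Real.pi) := by
  set s := ρ / 4 with hs
  have hs0 : 0 < s := by positivity
  have hcm : ∀ p, MeasurableSet (cell s p) := fun p => measurableSet_square _ _
  have hvol : ∀ p, volume (cell s p) = ENNReal.ofReal (s ^ 2) := fun p => volume_square _ hs0.le
  have hv0 : ENNReal.ofReal (s ^ 2) ≠ 0 := by
    rw [Ne, ENNReal.ofReal_eq_zero, not_le]; positivity
  -- in each cell, choose a centre at which `e` is at most its mean over the cell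
  set e : ℂ → ℝ≥0∞ := fun z => ∫⁻ x, ENNReal.ofReal (cut ρ (z - x)) ∂μ with he
  have hmeas : Measurable fun q : ℂ × ℂ => ENNReal.ofReal (cut ρ (q.1 - q.2)) :=
    ((measurable_cut ρ).comp (measurable_fst.sub measurable_snd)).ennreal_ofReal
  have hem : Measurable e := hmeas.lintegral_prod_right'
  have hex : ∀ p, ∃ z, z ∈ cell s p ∧ z ∉ N ∧
      ENNReal.ofReal (s ^ 2) * e z ≤ ∫⁻ z in cell s p, e z := by
    intro p
    have hne : volume.restrict (cell s p) ≠ 0 := by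
      rw [Ne, Measure.restrict_eq_zero, hvol]; exact hv0
    have : IsFiniteMeasure (volume.restrict (cell s p)) :=
      ⟨by rw [Measure.restrict_apply_univ, hvol]; exact ENNReal.ofReal_lt_top⟩
    have hnull : volume.restrict (cell s p) (N ∪ (cell s p)ᶜ) = 0 := by
      refine measure_union_null ?_ ?_
      · exact Measure.restrict_apply_eq_zero' (hcm p) |>.2
          (measure_mono_null Set.inter_subset_left hN)
      · rw [Measure.restrict_apply (hcm p).compl]; simp
    obtain ⟨z, hz, hle⟩ := exists_notMem_null_le_laverage hne hem.aemeasurable hnull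
    rw [Set.mem_union, not_or, Set.mem_compl_iff, not_not] at hz
    refine ⟨z, hz.2, hz.1, ?_⟩
    rw [setLAverage_eq, hvol, ENNReal.le_div_iff_mul_le (Or.inl hv0)
      (Or.inl ENNReal.ofReal_ne_top)] at hle
    rwa [mul_comm]
  choose ζ hζc hζN hζe using hex
  set M : ℤ := ⌈(‖z₀‖ + R) / s⌉ + 1 with hM
  refine ⟨Finset.Icc (-M) M ×ˢ Finset.Icc (-M) M, ζ, hζN, ?_, ?_⟩
  · intro w hw
    have hw1 : ‖w‖ < ‖z₀‖ + R := by
      rw [mem_ball_iff_norm] at hw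
      have := norm_sub_norm_le w z₀
      linarith
    have hfl : ∀ t : ℝ, |t| ≤ ‖w‖ → ⌊t / s⌋ ∈ Finset.Icc (-M) M := by
      intro t ht
      obtain ⟨h1, h2⟩ := abs_le.1 ht
      have h3 : (‖z₀‖ + R) / s ≤ ⌈(‖z₀‖ + R) / s⌉ := Int.le_ceil _
      have h4 : ‖w‖ / s ≤ (‖z₀‖ + R) / s := by gcongr
      have h5 : t / s ≤ ‖w‖ / s := by gcongr
      have h6 : -(‖w‖ / s) ≤ t / s := by rw [← neg_div]; gcongr
      rw [Finset.mem_Icc]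
      constructor
      · rw [Int.le_floor]; push_cast [hM]; linarith
      · have : (⌊t / s⌋ : ℝ) ≤ M := by
          push_cast [hM]; linarith [Int.floor_le (t / s)]
        exact_mod_cast this
    set p : ℤ × ℤ := (⌊w.re / s⌋, ⌊w.im / s⌋) with hp
    have hwp : w ∈ cell s p := (mem_cell_iff hs0).2 ⟨rfl, rfl⟩
    refine Set.mem_iUnion₂.2 ⟨p, Finset.mem_product.2 ⟨hfl _ (Complex.abs_re_le_norm w),
      hfl _ (Complex.abs_im_le_norm w)⟩, ?_⟩
    rw [mem_ball_iff_norm]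
    have := norm_sub_le_of_mem_square hwp (hζc p)
    linarith
  · set I := Finset.Icc (-M) M ×ˢ Finset.Icc (-M) M
    have hdisj : Set.PairwiseDisjoint (I : Set (ℤ × ℤ)) (cell s) := by
      intro p _ q _ hpq
      refine Set.disjoint_left.2 fun w hw hw' => hpq ?_
      rw [mem_cell_iff hs0] at hw hw'
      exact Prod.ext (hw.1.symm.trans hw'.1) (hw.2.symm.trans hw'.2)
    have h1 : ENNReal.ofReal (s ^ 2) * ∑ p ∈ I, e (ζ p) ≤ ENNReal.ofReal (2 * Real.pi * ρ ^ 2) := by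
      calc _ = ∑ p ∈ I, ENNReal.ofReal (s ^ 2) * e (ζ p) := Finset.mul_sum _ _ _
        _ ≤ ∑ p ∈ I, ∫⁻ z in cell s p, e z := Finset.sum_le_sum fun p _ => hζe p
        _ = ∫⁻ z in ⋃ p ∈ I, cell s p, e z :=
          (lintegral_biUnion_finset hdisj (fun p _ => hcm p) _).symm
        _ ≤ ∫⁻ z, e z := setLIntegral_le_lintegral _ _
        _ = ∫⁻ x, ∫⁻ z, ENNReal.ofReal (cut ρ (z - x)) ∂volume ∂μ :=
          lintegral_lintegral_swap hmeas.aemeasurable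
        _ = _ := by simp [lintegral_cut hρ.le]
    have h2 : ENNReal.ofReal (2 * Real.pi * ρ ^ 2)
        = ENNReal.ofReal (s ^ 2) * ENNReal.ofReal (32 * Real.pi) := by
      rw [← ENNReal.ofReal_mul (by positivity)]
      congr 1
      rw [hs]; ring
    rw [h2] at h1
    exact (ENNReal.mul_le_mul_iff_right hv0 ENNReal.ofReal_ne_top).1 h1

/-! ### The logarithm of the ratio is small in probability -/

section

variable {Ω : Type*} [MeasurableSpace Ω] {P : Measure Ω}
  {μ : Measure ℂ} [IsProbabilityMeasure μ] {X : ℕ → Ω → ℂ} {k : ℕ → ℕ}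

lemma volume_setOf_measure_singleton_ne_zero (μ : Measure ℂ) [IsProbabilityMeasure μ] :
    volume {z | μ {z} ≠ 0} = 0 := by
  have h := Measure.countable_meas_pos_of_disjoint_iUnion (μ := μ) (As := fun z : ℂ => {z})
    (fun z => measurableSet_singleton z)
    (fun z w hzw => Set.disjoint_singleton.2 hzw)
  simp only [pos_iff_ne_zero] at h
  exact h.measure_zero _

/-- Anti-concentration for the elementary symmetric functions of the `1 / (z - X i)`. If `z` is an
atom of `μ`, the corresponding terms are `0`, which does no harm. -/
lemma exists_tendsto_measure_elemSym_inv_le (hlaw : ∀ i, HasLaw (X i) μ P) (hindep : iIndepFun X P)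
    (hμ : ∀ x, μ ≠ Measure.dirac x)
    (hk : ∀ C : ℝ, 0 < C → Tendsto (fun n : ℕ => C ^ k n / (n : ℝ)) atTop (𝓝 0)) (z : ℂ) :
    ∃ κ > 0, Tendsto (fun n : ℕ =>
      P {ω | ‖elemSym (k n) fun i : Fin n => (z - X i ω)⁻¹‖ ≤ κ ^ k n / 2}) atTop (𝓝 0) := by
  set g : ℂ → ℂ := fun x => (z - x)⁻¹ with hg
  have hgm : Measurable g := by fun_prop
  set ν := μ.map g with hν
  have : IsProbabilityMeasure ν := Measure.isProbabilityMeasure_map hgm.aemeasurable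
  have hgg : ∀ x, z - (g x)⁻¹ = x := fun x => by simp [hg]
  have hν' : ∀ x, ν ≠ Measure.dirac x := by
    intro x hx
    refine hμ (z - x⁻¹) ?_
    have hm : Measurable fun y : ℂ => z - y⁻¹ := by fun_prop
    have h1 : ν.map (fun y => z - y⁻¹) = μ := by
      rw [hν, Measure.map_map hm hgm]
      convert Measure.map_id
      funext x
      exact hgg x
    rw [← h1, hx, Measure.map_dirac' hm]
  obtain ⟨κ, hκ, h⟩ := exists_tendsto_measureReal_elemSym_le ν hν' hk
  refine ⟨κ, hκ, ?_⟩
  rw [← ENNReal.ofReal_zero]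
  refine (ENNReal.tendsto_ofReal h).congr fun n => ?_
  have hY : ∀ i, HasLaw (fun ω => g (X i ω)) ν P := fun i =>
    HasLaw.fun_comp ⟨hgm.aemeasurable, rfl⟩ (hlaw i)
  have hind : iIndepFun (fun (i : Fin n) ω => g (X i ω)) P :=
    (hindep.comp (fun _ => g) fun _ => hgm).precomp Fin.val_injective
  have hpi := hind.hasLaw_pi (fun i : Fin n => hY i)
  rw [ofReal_measureReal]
  exact (hpi.measure_eq (p := fun y => ‖elemSym (k n) y‖ ≤ κ ^ k n / 2)
    (measurableSet_le (continuous_elemSym _).norm.measurable measurable_const)).symm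

/-- The normalised logarithm of `|P_n^{(k)} / P_n|` tends to `0` in probability in `L¹` of every
disc. -/
lemma tendsto_measure_integral_logRatio (hlaw : ∀ i, HasLaw (X i) μ P) (hindep : iIndepFun X P)
    (hμ : ∀ x, μ ≠ Measure.dirac x)
    (hk : ∀ C : ℝ, 0 < C → Tendsto (fun n : ℕ => C ^ k n / (n : ℝ)) atTop (𝓝 0))
    (hk' : Tendsto (fun n : ℕ => k n * (Real.log (1 + n) + 1) / (n : ℝ)) atTop (𝓝 0))
    (z₀ : ℂ) {R η : ℝ} (hη : 0 < η) :
    Tendsto (fun n : ℕ => P {ω | η * n <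
      ∫ z in Metric.ball z₀ R, |logRatio (fun i => X i ω) n (k n) z|}) atTop (𝓝 0) := by
  -- it suffices to bound the upper limit by a multiple of `ρ ^ 2`, for every scale `ρ`
  suffices H : ∀ ρ : ℝ, 0 < ρ → ∀ ε : ℝ≥0∞, 0 < ε → ∀ᶠ n : ℕ in atTop, P {ω | η * n <
      ∫ z in Metric.ball z₀ R, |logRatio (fun i => X i ω) n (k n) z|}
      ≤ ε + ENNReal.ofReal (64 * Real.pi ^ 2 * ρ ^ 2 / η) by
    rw [ENNReal.tendsto_nhds_zero]
    intro ε hε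
    have hε2 : 0 < ε / 2 := ENNReal.half_pos hε.ne'
    have h1 : Tendsto (fun ρ : ℝ => ENNReal.ofReal (64 * Real.pi ^ 2 * ρ ^ 2 / η)) (𝓝[>] 0)
        (𝓝 0) := by
      have : Tendsto (fun ρ : ℝ => 64 * Real.pi ^ 2 * ρ ^ 2 / η) (𝓝 0)
          (𝓝 (64 * Real.pi ^ 2 * 0 ^ 2 / η)) := by
        refine Continuous.tendsto ?_ 0
        fun_prop
      have h2 := ENNReal.tendsto_ofReal
        (this.mono_left (nhdsWithin_le_nhds (s := Set.Ioi (0 : ℝ))))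
      simpa using h2
    obtain ⟨ρ, hρ, hρε⟩ := ((eventually_mem_nhdsWithin).and
      (h1.eventually (eventually_le_nhds hε2))).exists
    filter_upwards [H ρ hρ (ε / 2) hε2] with n hn
    exact hn.trans ((add_le_add le_rfl hρε).trans_eq (ENNReal.add_halves ε))
  intro ρ hρ ε hε
  obtain ⟨I, ζ, hζN, hcover, hcut⟩ :=
    exists_finset_cover μ (volume_setOf_measure_singleton_ne_zero μ) z₀ R hρ
  choose κ hκ hanti using
    fun p => exists_tendsto_measure_elemSym_inv_le hlaw hindep hμ hk (ζ p)
  -- the threshold for the roots near the centres that makes their contribution `η n / 2`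
  set T : ℝ := η / (2 * (Real.pi * ρ ^ 2)) with hT
  have hT0 : 0 < T := by positivity
  set Cρ : ℝ := 2 * Real.pi + Real.pi * ρ ^ 2 with hCρ
  -- the deterministic part of the error
  set err : ℕ → ℝ := fun n => ∑ p ∈ I, (2 * (Cρ * (k n * (Real.log (1 + n) + 1) / n))
    + Real.pi * ρ ^ 2 * (-Real.log (κ p) * ((k n : ℝ) / n) + Real.log 2 * (n : ℝ)⁻¹)) with herr
  have hkn : Tendsto (fun n : ℕ => (k n : ℝ) / n) atTop (𝓝 0) := by
    refine squeeze_zero (fun n => by positivity) (fun n => ?_) hk'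
    gcongr
    refine le_mul_of_one_le_right (by positivity) ?_
    have := Real.log_nonneg (by linarith [Nat.cast_nonneg (α := ℝ) n] : (1 : ℝ) ≤ 1 + n)
    linarith
  have hinv : Tendsto (fun n : ℕ => (n : ℝ)⁻¹) atTop (𝓝 0) :=
    tendsto_inv_atTop_zero.comp tendsto_natCast_atTop_atTop
  have herr0 : Tendsto err atTop (𝓝 0) := by
    have : Tendsto err atTop (𝓝 (∑ p ∈ I, (2 * (Cρ * 0)
        + Real.pi * ρ ^ 2 * (-Real.log (κ p) * 0 + Real.log 2 * 0)))) :=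
      tendsto_finsetSum _ fun p _ => ((hk'.const_mul _).const_mul _).add
        (((hkn.const_mul _).add (hinv.const_mul _)).const_mul _)
    simpa using this
  have hprob : Tendsto (fun n : ℕ => ∑ p ∈ I,
      P {ω | ‖elemSym (k n) fun i : Fin n => (ζ p - X i ω)⁻¹‖ ≤ κ p ^ k n / 2}) atTop (𝓝 0) := by
    have := tendsto_finsetSum I fun p _ => hanti p
    simpa using this
  filter_upwards [herr0.eventually (eventually_lt_nhds (by linarith : 0 < η / 2)),
    hprob.eventually (eventually_le_nhds hε), eventually_gt_atTop 0,
    hkn.eventually (eventually_lt_nhds one_pos)] with n herrn hprobn hn0 hkn1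
  have hn0' : (0 : ℝ) < n := by exact_mod_cast hn0
  have hkn' : k n ≤ n := by
    rw [div_lt_one hn0'] at hkn1
    exact_mod_cast hkn1.le
  set S : Ω → ℝ := fun ω => ∑ p ∈ I, ∑ i ∈ Finset.range n, cut ρ (ζ p - X i ω) with hS
  have hXm : ∀ i, AEMeasurable (X i) P := fun i => (hlaw i).aemeasurable
  -- first moment bound for the number of roots close to the centres
  have hmarkov : P {ω | ENNReal.ofReal (n * T) ≤ ENNReal.ofReal (S ω)}
      ≤ ENNReal.ofReal (64 * Real.pi ^ 2 * ρ ^ 2 / η) := by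
    have hSm : AEMeasurable (fun ω => ENNReal.ofReal (S ω)) P := by
      refine AEMeasurable.ennreal_ofReal (Finset.aemeasurable_fun_sum _ fun p _ =>
        Finset.aemeasurable_fun_sum _ fun i _ => ?_)
      exact (measurable_cut ρ).comp_aemeasurable (aemeasurable_const.sub (hXm i))
    have hlint : ∫⁻ ω, ENNReal.ofReal (S ω) ∂P ≤ n * ENNReal.ofReal (32 * Real.pi) := by
      have e1 : ∀ ω, ENNReal.ofReal (S ω) = ∑ p ∈ I, ∑ i ∈ Finset.range n,
          ENNReal.ofReal (cut ρ (ζ p - X i ω)) := by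
        intro ω
        rw [ENNReal.ofReal_sum_of_nonneg fun p _ => Finset.sum_nonneg fun i _ => cut_nonneg hρ.le _]
        exact Finset.sum_congr rfl fun p _ =>
          ENNReal.ofReal_sum_of_nonneg fun i _ => cut_nonneg hρ.le _
      have hcm : ∀ p, Measurable fun x => ENNReal.ofReal (cut ρ (ζ p - x)) := fun p =>
        ((measurable_cut ρ).comp (measurable_const.sub measurable_id)).ennreal_ofReal
      have hae : ∀ p i, AEMeasurable (fun ω => ENNReal.ofReal (cut ρ (ζ p - X i ω))) P :=
        fun p i => (hcm p).comp_aemeasurable (hXm i)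
      simp only [e1]
      rw [lintegral_finsetSum' _ fun p _ => Finset.aemeasurable_fun_sum _ fun i _ => hae p i]
      have e2 : ∀ p ∈ I, ∫⁻ ω, ∑ i ∈ Finset.range n, ENNReal.ofReal (cut ρ (ζ p - X i ω)) ∂P
          = n * ∫⁻ x, ENNReal.ofReal (cut ρ (ζ p - x)) ∂μ := by
        intro p _
        rw [lintegral_finsetSum' _ fun i _ => hae p i]
        have e3 : ∀ i ∈ Finset.range n, ∫⁻ ω, ENNReal.ofReal (cut ρ (ζ p - X i ω)) ∂P
            = ∫⁻ x, ENNReal.ofReal (cut ρ (ζ p - x)) ∂μ := fun i _ =>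
          (hlaw i).lintegral_comp (hcm p).aemeasurable
        rw [Finset.sum_congr rfl e3]
        simp
      rw [Finset.sum_congr rfl e2, ← Finset.mul_sum]
      gcongr
    have hnT : ENNReal.ofReal (n * T) ≠ 0 := by
      rw [Ne, ENNReal.ofReal_eq_zero, not_le]; positivity
    refine (meas_ge_le_lintegral_div hSm hnT ENNReal.ofReal_ne_top).trans ?_
    refine (ENNReal.div_le_div_right hlint _).trans (le_of_eq ?_)
    rw [← ENNReal.ofReal_natCast, ← ENNReal.ofReal_mul (by positivity),
      ← ENNReal.ofReal_div_of_pos (by positivity)]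
    congr 1
    rw [hT]
    field_simp
    ring
  have hnull : P (⋃ p ∈ I, ⋃ i : ℕ, {ω | X i ω = ζ p}) = 0 := by
    refine (measure_biUnion_null_iff I.finite_toSet.countable).2 fun p _ => ?_
    rw [measure_iUnion_null_iff]
    intro i
    have := (hlaw i).measure_eq (p := fun x => x = ζ p) (measurableSet_singleton (ζ p))
    rw [this]
    have h2 := hζN p
    rw [Set.mem_ofPred_eq, not_not] at h2
    exact h2
  have hsub : {ω | η * n < ∫ z in Metric.ball z₀ R, |logRatio (fun i => X i ω) n (k n) z|}
      ⊆ ((⋃ p ∈ I, ⋃ i : ℕ, {ω | X i ω = ζ p}) ∪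
        (⋃ p ∈ I, {ω | ‖elemSym (k n) fun i : Fin n => (ζ p - X i ω)⁻¹‖ ≤ κ p ^ k n / 2})) ∪
        {ω | ENNReal.ofReal (n * T) ≤ ENNReal.ofReal (S ω)} := by
    intro ω hω
    by_contra hcon
    simp only [Set.mem_union, Set.mem_iUnion, Set.mem_ofPred_eq, not_or, not_exists, not_le]
      at hcon
    obtain ⟨⟨hne, hlow⟩, hSω⟩ := hcon
    rw [ENNReal.ofReal_lt_ofReal_iff (by positivity)] at hSω
    set x : ℕ → ℂ := fun i => X i ω with hx
    have hpos : ∀ c r, 0 ≤ ∫ z in Metric.ball c r, |logRatio x n (k n) z| := fun c r =>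
      integral_nonneg fun z => abs_nonneg _
    have h1 : ∫ z in Metric.ball z₀ R, |logRatio x n (k n) z|
        ≤ ∑ p ∈ I, ∫ z in Metric.ball (ζ p) ρ, |logRatio x n (k n) z| := by
      have hint : ∀ p ∈ I, IntegrableOn (fun z => |logRatio x n (k n) z|) (Metric.ball (ζ p) ρ) :=
        fun p _ => (integrableOn_logRatio hkn' (ζ p) hρ).abs
      have hintU : IntegrableOn (fun z => |logRatio x n (k n) z|)
          (⋃ p ∈ I, Metric.ball (ζ p) ρ) := (integrableOn_finset_iUnion).2 hint
      refine (setIntegral_mono_set hintU (ae_of_all _ fun z => abs_nonneg _)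
        hcover.eventuallyLE).trans ?_
      have h2 : volume.restrict (⋃ p ∈ I, Metric.ball (ζ p) ρ)
          ≤ ∑ p ∈ I, volume.restrict (Metric.ball (ζ p) ρ) := by
        rw [← Measure.sum_coe_finset]
        have := Measure.restrict_iUnion_le (μ := volume)
          (s := fun p : I => Metric.ball (ζ p) ρ)
        rwa [Set.iUnion_subtype] at this
      rw [← integral_finsetSum_measure hint]
      exact integral_mono_measure h2 (ae_of_all _ fun z => abs_nonneg _)
        (integrable_finsetSum_measure.2 hint)
    have h2 : ∀ p ∈ I, ∫ z in Metric.ball (ζ p) ρ, |logRatio x n (k n) z|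
        ≤ n * (2 * (Cρ * (k n * (Real.log (1 + n) + 1) / n))
          + Real.pi * ρ ^ 2 * (-Real.log (κ p) * ((k n : ℝ) / n) + Real.log 2 * (n : ℝ)⁻¹))
          + Real.pi * ρ ^ 2 * ∑ i ∈ Finset.range n, cut ρ (ζ p - x i) := by
      intro p hp
      have hP : (rootPoly x n).eval (ζ p) ≠ 0 := by
        rw [eval_rootPoly, Finset.prod_ne_zero_iff]
        intro i _
        rw [sub_ne_zero]
        exact fun h => hne p hp i h.symm
      have hκp := hκ p
      have h3 := setIntegral_abs_logRatio_le hkn' hρ hP (a := κ p ^ k n / 2) (by positivity)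
        (hlow p hp).le
      rw [Real.log_div (by positivity) (by norm_num), Real.log_pow] at h3
      refine h3.trans_eq ?_
      field_simp
      ring
    have h3 : ∫ z in Metric.ball z₀ R, |logRatio x n (k n) z|
        ≤ n * err n + Real.pi * ρ ^ 2 * S ω := by
      refine h1.trans ((Finset.sum_le_sum h2).trans_eq ?_)
      rw [Finset.sum_add_distrib, ← Finset.mul_sum, ← Finset.mul_sum]
    have h4 : Real.pi * ρ ^ 2 * S ω < n * (η / 2) := by
      calc _ < Real.pi * ρ ^ 2 * (n * T) := by gcongr
        _ = _ := by rw [hT]; field_simp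
    have h5 : n * err n < n * (η / 2) := by gcongr
    rw [Set.mem_ofPred_eq] at hω
    linarith
  refine (measure_mono hsub).trans ((measure_union_le _ _).trans (add_le_add ?_ hmarkov))
  refine (measure_union_le _ _).trans ?_
  rw [hnull, zero_add]
  exact (measure_biUnion_finset_le _ _).trans hprobn

end

/-! ### Bumps determine weak convergence -/

section

lemma hasCompactSupport_bump {R : ℝ} (hR : 0 < R) :
    HasCompactSupport fun w : ℂ => bump R ‖w‖ := by
  refine HasCompactSupport.intro (isCompact_closedBall 0 (2 * R)) fun w hw => ?_
  rw [mem_closedBall_zero_iff, not_le] at hw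
  exact bump_eq_zero hR hw.le

/-- The bump of scale `R` centred at `z`, as a bounded continuous function. -/
noncomputable def bumpBCF {R : ℝ} (hR : 0 < R) (z : ℂ) : ℂ →ᵇ ℝ :=
  BoundedContinuousFunction.ofNormedAddCommGroup (fun w => bump R ‖z - w‖)
    ((continuous_bump hR).comp (by fun_prop)) (Real.log 2) fun w => by
      rw [Real.norm_of_nonneg (bump_nonneg hR _)]; exact bump_le_log_two hR _

lemma continuous_bumpBCF {R : ℝ} (hR : 0 < R) : Continuous (bumpBCF hR) := by
  have hu : UniformContinuous fun w : ℂ => bump R ‖w‖ :=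
    (hasCompactSupport_bump hR).uniformContinuous_of_continuous
      ((continuous_bump hR).comp continuous_norm)
  rw [Metric.continuous_iff]
  intro z ε hε
  obtain ⟨δ, hδ, h⟩ := Metric.uniformContinuous_iff.1 hu (ε / 2) (by positivity)
  refine ⟨δ, hδ, fun z' hz' => ?_⟩
  refine lt_of_le_of_lt ((BoundedContinuousFunction.dist_le (by positivity)).2 fun w => ?_)
    (half_lt_self hε)
  exact (h (a := z' - w) (b := z - w) (by rwa [dist_sub_right])).le

/-- The bounded continuous functions whose integrals converge along a filter of measures to the
integral against `μ`. -/
def convergenceSubmodule (𝒢 : Filter (FiniteMeasure ℂ)) (μ : FiniteMeasure ℂ) :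
    Submodule ℝ (ℂ →ᵇ ℝ) where
  carrier := {f | Tendsto (fun ν : FiniteMeasure ℂ => ∫ w, f w ∂(ν : Measure ℂ)) 𝒢
    (𝓝 (∫ w, f w ∂(μ : Measure ℂ)))}
  add_mem' := by
    intro f g hf hg
    simp only [Set.mem_ofPred_eq, BoundedContinuousFunction.coe_add, Pi.add_apply] at *
    have e : ∀ ν : FiniteMeasure ℂ, ∫ w, (f w + g w) ∂(ν : Measure ℂ)
        = ∫ w, f w ∂(ν : Measure ℂ) + ∫ w, g w ∂(ν : Measure ℂ) := fun ν =>
      integral_add (f.integrable _) (g.integrable _)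
    simp only [e]
    exact hf.add hg
  zero_mem' := by simpa using tendsto_const_nhds
  smul_mem' := by
    intro c f hf
    simp only [Set.mem_ofPred_eq, BoundedContinuousFunction.coe_smul, integral_smul] at *
    exact hf.const_smul c

variable {𝒢 : Filter (FiniteMeasure ℂ)} {μ : FiniteMeasure ℂ}

lemma isClosed_convergenceSubmodule [IsProbabilityMeasure (μ : Measure ℂ)]
    (h1 : ∀ᶠ ν : FiniteMeasure ℂ in 𝒢, IsProbabilityMeasure (ν : Measure ℂ)) :
    IsClosed (convergenceSubmodule 𝒢 μ : Set (ℂ →ᵇ ℝ)) := by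
  refine isClosed_of_closure_subset fun f hf => ?_
  change Tendsto _ _ _
  rw [Metric.tendsto_nhds]
  intro ε hε
  obtain ⟨g, hg, hfg⟩ := Metric.mem_closure_iff.1 hf (ε / 3) (by positivity)
  have hg' : Tendsto (fun ν : FiniteMeasure ℂ => ∫ w, g w ∂(ν : Measure ℂ)) 𝒢
    (𝓝 (∫ w, g w ∂(μ : Measure ℂ))) := hg
  have key : ∀ ν : FiniteMeasure ℂ, IsProbabilityMeasure (ν : Measure ℂ) →
      |∫ w, f w ∂(ν : Measure ℂ) - ∫ w, g w ∂(ν : Measure ℂ)| < ε / 3 := by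
    intro ν hν
    rw [← integral_sub (f.integrable _) (g.integrable _)]
    refine lt_of_le_of_lt ?_ hfg
    have := norm_integral_le_of_norm_le_const (μ := (ν : Measure ℂ)) (C := dist f g)
      (f := fun w => f w - g w)
      (ae_of_all _ fun w => by
        rw [← dist_eq_norm]; exact BoundedContinuousFunction.dist_coe_le_dist w)
    simpa using this
  filter_upwards [h1, (Metric.tendsto_nhds.1 hg') (ε / 3) (by positivity)] with ν hν hgν
  have k1 := abs_lt.1 (key ν hν)
  have k2 := abs_lt.1 (key μ inferInstance)
  rw [Real.dist_eq] at hgν ⊢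
  have k3 := abs_lt.1 hgν
  exact abs_lt.2 ⟨by linarith, by linarith⟩

/-- Compactly supported continuous functions are uniform limits of convolutions with bumps, and
the convolutions lie in the closed span of the bumps. -/
lemma mem_convergenceSubmodule_of_hasCompactSupport [IsProbabilityMeasure (μ : Measure ℂ)]
    (h1 : ∀ᶠ ν : FiniteMeasure ℂ in 𝒢, IsProbabilityMeasure (ν : Measure ℂ))
    (hb : ∀ (z : ℂ) (R : ℝ) (hR : 0 < R), bumpBCF hR z ∈ convergenceSubmodule 𝒢 μ)
    (φ : ℂ →ᵇ ℝ) (hφ : HasCompactSupport φ) : φ ∈ convergenceSubmodule 𝒢 μ := by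
  have hclosed := isClosed_convergenceSubmodule (μ := μ) h1
  have hu : UniformContinuous φ := hφ.uniformContinuous_of_continuous φ.continuous
  change φ ∈ (convergenceSubmodule 𝒢 μ : Set (ℂ →ᵇ ℝ))
  rw [← hclosed.closure_eq, Metric.mem_closure_iff]
  intro ε hε
  obtain ⟨δ, hδ, hφδ⟩ := Metric.uniformContinuous_iff.1 hu (ε / 2) (by positivity)
  set R := δ / 4 with hRdef
  have hR : 0 < R := by positivity
  have hBc : Continuous fun w : ℂ => bump R ‖w‖ := (continuous_bump hR).comp continuous_norm
  have hBi : Integrable fun w : ℂ => bump R ‖w‖ :=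
    hBc.integrable_of_hasCompactSupport (hasCompactSupport_bump hR)
  set m := ∫ w : ℂ, bump R ‖w‖ with hm
  have hm0 : 0 < m := by
    refine hBc.integral_pos_of_hasCompactSupport_nonneg_nonzero (hasCompactSupport_bump hR)
      (fun w => bump_nonneg hR _) (x := 0) ?_
    rw [norm_zero]
    exact (bump_zero_pos hR).ne'
  set F : ℂ → ℂ →ᵇ ℝ := fun z => φ z • bumpBCF hR z with hF
  have hFc : Continuous F := φ.continuous.smul (continuous_bumpBCF hR)
  have hFs : HasCompactSupport F := hφ.smul_right
  have hFi : Integrable F := hFc.integrable_of_hasCompactSupport hFs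
  obtain ⟨r, hr⟩ : ∃ r : ℝ, tsupport F ⊆ Metric.closedBall 0 r :=
    hFs.isBounded.subset_closedBall 0
  set K := Metric.closedBall (0 : ℂ) (max r 1) with hK
  have hKF : ∫ z in K, F z = ∫ z, F z := by
    refine setIntegral_eq_integral_of_forall_compl_eq_zero fun z hz => ?_
    by_contra hne
    exact hz (Metric.closedBall_subset_closedBall (le_max_left _ _) (hr (subset_tsupport _ hne)))
  have hvol : volume K ≠ 0 :=
    (Metric.measure_closedBall_pos _ _ (lt_max_of_lt_right one_pos)).ne'
  have hmem : ∫ z, F z ∈ convergenceSubmodule 𝒢 μ := by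
    have havg : ⨍ z in K, F z ∈ (convergenceSubmodule 𝒢 μ : Set (ℂ →ᵇ ℝ)) :=
      (convergenceSubmodule 𝒢 μ).convex.set_average_mem hclosed hvol
        measure_closedBall_lt_top.ne
        (ae_of_all _ fun z => Submodule.smul_mem _ _ (hb z R hR)) hFi.integrableOn
    rw [setAverage_eq, hKF] at havg
    have h2 := Submodule.smul_mem _ (volume.real K) havg
    rwa [smul_smul, mul_inv_cancel₀, one_smul] at h2
    exact (ENNReal.toReal_ne_zero).2 ⟨hvol, measure_closedBall_lt_top.ne⟩
  refine ⟨m⁻¹ • ∫ z, F z, Submodule.smul_mem _ _ hmem, ?_⟩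
  refine lt_of_le_of_lt ((BoundedContinuousFunction.dist_le (by positivity)).2 fun w => ?_)
    (half_lt_self hε)
  have heval : (∫ z, F z) w = ∫ z, φ z * bump R ‖z - w‖ := by
    have := (BoundedContinuousFunction.evalCLM ℝ w).integral_comp_comm hFi
    exact this.symm
  have hshift : ∫ z, bump R ‖z - w‖ = m := integral_sub_right_eq_self (fun z => bump R ‖z‖) w
  have hBi' : Integrable fun z : ℂ => bump R ‖z - w‖ := hBi.comp_sub_right w
  have hφBi : Integrable fun z : ℂ => φ z * bump R ‖z - w‖ :=
    hBi'.bdd_mul φ.continuous.aestronglyMeasurable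
      (ae_of_all _ fun z => φ.norm_coe_le_norm z)
  have hpt : (m⁻¹ • ∫ z, F z) w = m⁻¹ * ∫ z, φ z * bump R ‖z - w‖ := by
    rw [← heval]; rfl
  have hdiff : (m⁻¹ • ∫ z, F z) w - φ w = m⁻¹ * ∫ z, (φ z - φ w) * bump R ‖z - w‖ := by
    simp only [sub_mul]
    rw [integral_sub hφBi (hBi'.const_mul _), integral_const_mul, hshift, mul_sub,
      hpt]
    field_simp
  rw [dist_comm, Real.dist_eq, hdiff, abs_mul, abs_of_pos (inv_pos.2 hm0), inv_mul_le_iff₀ hm0,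
    ← hshift, ← integral_mul_const]
  refine (abs_integral_le_integral_abs).trans (integral_mono_of_nonneg
    (ae_of_all _ fun z => abs_nonneg _) (hBi'.mul_const _) (ae_of_all _ fun z => ?_))
  simp only
  rw [abs_mul, abs_of_nonneg (bump_nonneg hR _), mul_comm]
  rcases lt_or_ge ‖z - w‖ (2 * R) with h | h
  · have := (hφδ (a := z) (b := w) (by rw [dist_eq_norm]; linarith)).le
    rw [Real.dist_eq] at this
    exact mul_le_mul_of_nonneg_left this (bump_nonneg hR _)
  · rw [bump_eq_zero hR h]; simp

/-- A continuous cutoff, equal to `1` on the disc of radius `m`. -/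
noncomputable def cutoff (m : ℕ) : ℂ →ᵇ ℝ :=
  BoundedContinuousFunction.ofNormedAddCommGroup (fun w => max 0 (min 1 (m + 1 - ‖w‖)))
    (by fun_prop) 1 fun w => by
      rw [Real.norm_of_nonneg (le_max_left _ _)]
      exact max_le zero_le_one (min_le_left _ _)

lemma cutoff_nonneg (m : ℕ) (w : ℂ) : 0 ≤ cutoff m w := le_max_left _ _

lemma cutoff_le_one (m : ℕ) (w : ℂ) : cutoff m w ≤ 1 := max_le zero_le_one (min_le_left _ _)

lemma hasCompactSupport_cutoff (m : ℕ) : HasCompactSupport (cutoff m) := by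
  refine HasCompactSupport.intro (isCompact_closedBall 0 (m + 1)) fun w hw => ?_
  rw [mem_closedBall_zero_iff, not_le] at hw
  exact max_eq_left ((min_le_right _ _).trans (by linarith))

lemma tendsto_integral_cutoff (μ : Measure ℂ) [IsProbabilityMeasure μ] :
    Tendsto (fun m => ∫ w, cutoff m w ∂μ) atTop (𝓝 1) := by
  have h : Tendsto (fun m => ∫ w, cutoff m w ∂μ) atTop (𝓝 (∫ _, (1 : ℝ) ∂μ)) := by
    refine tendsto_integral_of_dominated_convergence (fun _ => 1)
      (fun m => (cutoff m).continuous.aestronglyMeasurable) (integrable_const _)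
      (fun m => ae_of_all _ fun w => ?_) (ae_of_all _ fun w => ?_)
    · rw [Real.norm_of_nonneg (cutoff_nonneg m w)]; exact cutoff_le_one m w
    · refine tendsto_const_nhds.congr' ?_
      filter_upwards [eventually_ge_atTop ⌈‖w‖⌉₊] with m hm
      have h1 : ‖w‖ ≤ m := (Nat.le_ceil _).trans (by exact_mod_cast hm)
      change (1 : ℝ) = max 0 (min 1 (m + 1 - ‖w‖))
      rw [min_eq_left (by linarith), max_eq_right zero_le_one]
  simpa using h

/-- Convergence of the bump statistics of probability measures implies weak convergence. -/
lemma le_nhds_of_tendsto_bump [IsProbabilityMeasure (μ : Measure ℂ)]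
    (h1 : ∀ᶠ ν : FiniteMeasure ℂ in 𝒢, IsProbabilityMeasure (ν : Measure ℂ))
    (hb : ∀ (z : ℂ) (R : ℝ), 0 < R → Tendsto
      (fun ν : FiniteMeasure ℂ => ∫ w, bump R ‖z - w‖ ∂(ν : Measure ℂ)) 𝒢
      (𝓝 (∫ w, bump R ‖z - w‖ ∂(μ : Measure ℂ)))) :
    𝒢 ≤ 𝓝 μ := by
  have hcs := mem_convergenceSubmodule_of_hasCompactSupport (μ := μ) h1
    (fun z R hR => hb z R hR)
  change Tendsto id 𝒢 (𝓝 μ)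
  rw [FiniteMeasure.tendsto_iff_forall_integral_tendsto]
  intro f
  rw [Metric.tendsto_nhds]
  intro ε hε
  set M := ‖f‖ + 1 with hM
  have hM0 : 0 < M := by positivity
  set η := ε / (4 * M) with hη
  have hη0 : 0 < η := by positivity
  obtain ⟨m, hm⟩ := ((tendsto_integral_cutoff (μ : Measure ℂ)).eventually
    (eventually_gt_nhds (by linarith : 1 - η < 1))).exists
  have hχ : Tendsto (fun ν : FiniteMeasure ℂ => ∫ w, cutoff m w ∂(ν : Measure ℂ)) 𝒢
      (𝓝 (∫ w, cutoff m w ∂(μ : Measure ℂ))) := hcs (cutoff m) (hasCompactSupport_cutoff m)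
  have hfχ : Tendsto (fun ν : FiniteMeasure ℂ => ∫ w, (f * cutoff m) w ∂(ν : Measure ℂ)) 𝒢
      (𝓝 (∫ w, (f * cutoff m) w ∂(μ : Measure ℂ))) :=
    hcs (f * cutoff m) ((hasCompactSupport_cutoff m).mul_left)
  have key : ∀ ν : FiniteMeasure ℂ, IsProbabilityMeasure (ν : Measure ℂ) →
      |∫ w, f w ∂(ν : Measure ℂ) - ∫ w, (f * cutoff m) w ∂(ν : Measure ℂ)|
        ≤ M * (1 - ∫ w, cutoff m w ∂(ν : Measure ℂ)) := by
    intro ν hν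
    have e1 : 1 - ∫ w, cutoff m w ∂(ν : Measure ℂ) = ∫ w, (1 - cutoff m w) ∂(ν : Measure ℂ) := by
      rw [integral_sub (integrable_const _) ((cutoff m).integrable _)]; simp
    rw [e1, ← integral_const_mul, ← integral_sub (f.integrable _) ((f * cutoff m).integrable _)]
    refine (abs_integral_le_integral_abs).trans (integral_mono_of_nonneg
      (ae_of_all _ fun w => abs_nonneg _)
      (((integrable_const _).sub ((cutoff m).integrable _)).const_mul _)
      (ae_of_all _ fun w => ?_))
    have e2 : f w - (f * cutoff m) w = f w * (1 - cutoff m w) := by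
      rw [BoundedContinuousFunction.coe_mul, Pi.mul_apply]; ring
    have h3 : 0 ≤ 1 - cutoff m w := by linarith [cutoff_le_one m w]
    simp only
    rw [e2, abs_mul, abs_of_nonneg h3]
    have h4 : |f w| ≤ M := (f.norm_coe_le_norm w).trans (by linarith)
    gcongr
  filter_upwards [h1, hχ.eventually (eventually_gt_nhds hm),
    (Metric.tendsto_nhds.1 hfχ) (ε / 4) (by positivity)] with ν hν hχν hfν
  have k1 := abs_le.1 (key ν hν)
  have k2 := abs_le.1 (key μ inferInstance)
  rw [Real.dist_eq] at hfν ⊢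
  have k3 := abs_lt.1 hfν
  have hMη : M * η = ε / 4 := by rw [hη]; field_simp
  have k4 : M * (1 - ∫ w, cutoff m w ∂(ν : Measure ℂ)) ≤ M * η := by gcongr; linarith
  have k5 : M * (1 - ∫ w, cutoff m w ∂(μ : Measure ℂ)) ≤ M * η := by gcongr; linarith
  simp only [id]
  exact abs_lt.2 ⟨by linarith, by linarith⟩

end

/-! ### Convergence of the zero measures -/

section Growth

variable {k : ℕ → ℕ}

lemma tendsto_log_log_natCast : Tendsto (fun n : ℕ => Real.log (Real.log n)) atTop atTop :=
  Real.tendsto_log_atTop.comp (Real.tendsto_log_atTop.comp tendsto_natCast_atTop_atTop)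

lemma tendsto_pow_div_of_le_log_div_log_log
    (hk : ∀ᶠ n : ℕ in atTop, (k n : ℝ) ≤ Real.log n / (5 * Real.log (Real.log n)))
    {C : ℝ} (hC : 0 < C) : Tendsto (fun n : ℕ => C ^ k n / (n : ℝ)) atTop (𝓝 0) := by
  have hlog : Tendsto (fun n : ℕ => Real.log n) atTop atTop :=
    Real.tendsto_log_atTop.comp tendsto_natCast_atTop_atTop
  have h0 : Tendsto (fun n : ℕ => Real.exp (-(Real.log n / 2))) atTop (𝓝 0) :=
    Real.tendsto_exp_neg_atTop_nhds_zero.comp (hlog.atTop_div_const two_pos)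
  refine squeeze_zero' (Eventually.of_forall fun n => by positivity) ?_ h0
  filter_upwards [hk, eventually_gt_atTop 0, hlog.eventually_ge_atTop 0,
    tendsto_log_log_natCast.eventually_ge_atTop (max 1 (Real.log C))] with n hn hn0 hL hLL
  have hn' : (0 : ℝ) < n := by exact_mod_cast hn0
  set L := Real.log n with hLdef
  set LL := Real.log L
  have h1 : 1 ≤ LL := (le_max_left _ _).trans hLL
  have h2 : Real.log C ≤ LL := (le_max_right _ _).trans hLL
  have h3 : k n * Real.log C ≤ L / 2 := by
    calc (k n : ℝ) * Real.log C ≤ k n * LL := by gcongr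
      _ ≤ L / (5 * LL) * LL := by gcongr
      _ = L / 5 := by field_simp
      _ ≤ L / 2 := by linarith
  have h4 : C ^ k n = Real.exp (k n * Real.log C) := by
    rw [Real.exp_nat_mul, Real.exp_log hC]
  rw [h4, div_le_iff₀ hn']
  calc Real.exp (k n * Real.log C) ≤ Real.exp (-(L / 2) + L) := Real.exp_le_exp.2 (by linarith)
    _ = Real.exp (-(L / 2)) * n := by rw [Real.exp_add, hLdef, Real.exp_log hn']

lemma tendsto_mul_log_div_of_le_log_div_log_log
    (hk : ∀ᶠ n : ℕ in atTop, (k n : ℝ) ≤ Real.log n / (5 * Real.log (Real.log n))) :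
    Tendsto (fun n : ℕ => k n * (Real.log (1 + n) + 1) / (n : ℝ)) atTop (𝓝 0) := by
  have hlog : Tendsto (fun n : ℕ => Real.log n) atTop atTop :=
    Real.tendsto_log_atTop.comp tendsto_natCast_atTop_atTop
  have h0 : Tendsto (fun n : ℕ => 3 * (Real.log n ^ 2 / n)) atTop (𝓝 0) := by
    have := ((Real.isLittleO_pow_log_id_atTop (n := 2)).tendsto_div_nhds_zero.comp
      (tendsto_natCast_atTop_atTop (R := ℝ))).const_mul 3
    simpa using this
  refine squeeze_zero' ?_ ?_ h0
  · refine Eventually.of_forall fun n => ?_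
    have : 0 ≤ Real.log (1 + n) := Real.log_nonneg (by simp)
    positivity
  filter_upwards [hk, eventually_ge_atTop 1, hlog.eventually_ge_atTop 1,
    tendsto_log_log_natCast.eventually_ge_atTop 1] with n hn hn0 hL hLL
  have hn' : (1 : ℝ) ≤ n := by exact_mod_cast hn0
  have h1 : (k n : ℝ) ≤ Real.log n := hn.trans (div_le_self (by linarith) (by linarith))
  have h2 : Real.log (1 + n) ≤ Real.log n + 1 := by
    calc Real.log (1 + n) ≤ Real.log (2 * n) := Real.log_le_log (by positivity) (by linarith)
      _ = Real.log 2 + Real.log n := Real.log_mul (by norm_num) (by positivity)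
      _ ≤ Real.log n + 1 := by linarith [Real.log_two_lt_d9]
  rw [← mul_div_assoc]
  refine div_le_div_of_nonneg_right ?_ (by positivity)
  have h3 : 0 ≤ Real.log (1 + n) := Real.log_nonneg (by simp)
  calc (k n : ℝ) * (Real.log (1 + n) + 1) ≤ Real.log n * (Real.log n + 1 + 1) := by
        gcongr
    _ ≤ 3 * Real.log n ^ 2 := by nlinarith

end Growth

section ZeroMeasure

lemma sum_pointMass_univ (s : Multiset ℂ) :
    ((s.map pointMass).sum : Measure ℂ) Set.univ = s.card := by
  induction s using Multiset.induction_on with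
  | empty => simp
  | cons a s ih =>
    rw [Multiset.map_cons, Multiset.sum_cons, FiniteMeasure.toMeasure_add, Measure.add_apply, ih]
    simp [pointMass, add_comm]

lemma integral_sum_pointMass (s : Multiset ℂ) (f : ℂ →ᵇ ℝ) :
    ∫ w, f w ∂((s.map pointMass).sum : Measure ℂ) = (s.map f).sum := by
  induction s using Multiset.induction_on with
  | empty => simp
  | cons a s ih =>
    rw [Multiset.map_cons, Multiset.sum_cons, FiniteMeasure.toMeasure_add,
      integral_add_measure (f.integrable _) (f.integrable _), ih]
    simp [pointMass]

lemma isProbabilityMeasure_zeroMeasure (x : ℕ → ℂ) {n k : ℕ} (hk : k < n) :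
    IsProbabilityMeasure (zeroMeasure x n k : Measure ℂ) := by
  constructor
  have h : ((n - k : ℕ) : ℝ≥0) ≠ 0 := by
    rw [Nat.cast_ne_zero]; omega
  rw [zeroMeasure, FiniteMeasure.toMeasure_smul, Measure.smul_apply, sum_pointMass_univ,
    card_roots_iterate_derivative x hk.le, ENNReal.smul_def, smul_eq_mul, ENNReal.coe_inv h]
  exact ENNReal.inv_mul_cancel (by exact_mod_cast h) (by simp)

lemma integral_zeroMeasure (x : ℕ → ℂ) (n k : ℕ) (f : ℂ →ᵇ ℝ) :
    ∫ w, f w ∂(zeroMeasure x n k : Measure ℂ)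
      = ((n - k : ℕ) : ℝ)⁻¹ * ((Polynomial.derivative^[k] (rootPoly x n)).roots.map f).sum := by
  rw [zeroMeasure, FiniteMeasure.toMeasure_smul, integral_smul_nnreal_measure,
    integral_sum_pointMass]
  rw [NNReal.smul_def, NNReal.coe_inv, NNReal.coe_natCast, smul_eq_mul]

lemma zeroMeasure_const (x : ℂ) {n k : ℕ} (hk : k < n) :
    zeroMeasure (fun _ => x) n k = pointMass x := by
  have h : ((n - k : ℕ) : ℝ≥0) ≠ 0 := by
    rw [Nat.cast_ne_zero]; omega
  have h1 : ((n.descFactorial k : ℕ) : ℂ) ≠ 0 := by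
    rw [Nat.cast_ne_zero]; exact (Nat.descFactorial_pos.2 hk.le).ne'
  have h2 : (Polynomial.derivative^[k] (rootPoly (fun _ => x) n)).roots = (n - k) • {x} := by
    rw [rootPoly, Finset.prod_const, Finset.card_range, Polynomial.iterate_derivative_X_sub_pow,
      nsmul_eq_mul, ← Polynomial.C_eq_natCast, Polynomial.roots_C_mul _ h1, Polynomial.roots_pow,
      Polynomial.roots_X_sub_C]
  rw [zeroMeasure, h2, Multiset.map_nsmul, Multiset.sum_nsmul, Multiset.map_singleton,
    Multiset.sum_singleton, ← Nat.cast_smul_eq_nsmul ℝ≥0, smul_smul, inv_mul_cancel₀ h, one_smul]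

lemma zeroMeasure_congr {x y : ℕ → ℂ} {n : ℕ} (h : ∀ i < n, x i = y i) (k : ℕ) :
    zeroMeasure x n k = zeroMeasure y n k := by
  have : rootPoly x n = rootPoly y n :=
    Finset.prod_congr rfl fun i hi => by rw [h i (Finset.mem_range.1 hi)]
  rw [zeroMeasure, zeroMeasure, this]

/-- The bump statistics of the zeros of the `k`-th derivative differ from those of the original
roots by at most the local `L¹` norm of the logarithmic ratio, up to the change of normalization
from `n` to `n - k`. -/
lemma abs_integral_zeroMeasure_bump_sub_le (x : ℕ → ℂ) {n k : ℕ} (hn : 0 < n) (hk : 2 * k ≤ n)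
    (c : ℂ) {R : ℝ} (hR : 0 < R) :
    |∫ w, bump R ‖c - w‖ ∂(zeroMeasure x n k : Measure ℂ)
        - (∑ i ∈ Finset.range n, bump R ‖c - x i‖) / n|
      ≤ 4 / (Real.pi * R ^ 2) * ((∫ z in Metric.ball c (2 * R), |logRatio x n k z|) / n)
        + 2 * (k / n) := by
  have hkn : k ≤ n := by omega
  have hn' : (0 : ℝ) < n := by exact_mod_cast hn
  have hnk : ((n - k : ℕ) : ℝ) = n - k := by push_cast [hkn]; ring
  have h2k : 2 * (k : ℝ) ≤ n := by exact_mod_cast hk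
  have hnk' : (n : ℝ) / 2 ≤ n - k := by linarith
  have hpos : (0 : ℝ) < n - k := by linarith
  have hI : 0 ≤ ∫ z in Metric.ball c (2 * R), |logRatio x n k z| :=
    integral_nonneg fun z => abs_nonneg _
  have e := integral_zeroMeasure x n k (bumpBCF hR c)
  have hb := abs_sum_bump_sub_le (x := x) hkn c hR
  set I := ∫ z in Metric.ball c (2 * R), |logRatio x n k z|
  set S := ∑ i ∈ Finset.range n, bump R ‖c - x i‖ with hS
  set T := ((Polynomial.derivative^[k] (rootPoly x n)).roots.map fun w => bump R ‖c - w‖).sum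
  have e' : ∫ w, bump R ‖c - w‖ ∂(zeroMeasure x n k : Measure ℂ) = (n - k : ℝ)⁻¹ * T := by
    rw [← hnk]; exact e
  have hS0 : 0 ≤ S := Finset.sum_nonneg fun i _ => bump_nonneg hR _
  have hSn : S ≤ n := by
    calc S ≤ ∑ i ∈ Finset.range n, (1 : ℝ) := Finset.sum_le_sum fun i _ =>
          (bump_le_log_two hR _).trans (by linarith [Real.log_two_lt_d9])
      _ = n := by simp
  have hsplit : (n - k : ℝ)⁻¹ * T - S / n
      = (n - k : ℝ)⁻¹ * (T - S) + (n - k : ℝ)⁻¹ * (S * (k / n)) := by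
    field_simp
    ring
  have hinv : (n - k : ℝ)⁻¹ ≤ 2 / n := by
    rw [inv_le_comm₀ hpos (by positivity), inv_div]; exact hnk'
  rw [e', hsplit]
  refine (abs_add_le _ _).trans (add_le_add ?_ ?_)
  · rw [abs_mul, abs_of_pos (inv_pos.2 hpos)]
    calc (n - k : ℝ)⁻¹ * |T - S| ≤ 2 / n * (2 / (Real.pi * R ^ 2) * I) := by gcongr
      _ = 4 / (Real.pi * R ^ 2) * (I / n) := by field_simp; ring
  · rw [abs_of_nonneg (by positivity)]
    calc (n - k : ℝ)⁻¹ * (S * (k / n)) ≤ 2 / n * (n * (k / n)) := by gcongr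
      _ = 2 * (k / n) := by field_simp

end ZeroMeasure

section Probability

variable {Ω : Type*} [MeasurableSpace Ω] {P : Measure Ω}

/-- Convergence of `Y n` to `c` in probability is the inclusion of this filter in `𝓝 c`. -/
def probabilityFilter {E : Type*} (P : Measure Ω) (Y : ℕ → Ω → E) : Filter E where
  sets := {V | Tendsto (fun n => P {ω | Y n ω ∉ V}) atTop (𝓝 0)}
  univ_sets := by simp
  sets_of_superset := by
    intro V W hV hVW
    exact tendsto_of_tendsto_of_tendsto_of_le_of_le tendsto_const_nhds hV (fun _ => zero_le)
      fun n => measure_mono fun ω hω h => hω (hVW h)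
  inter_sets := by
    intro V W hV hW
    have h := Tendsto.add hV hW
    rw [add_zero] at h
    refine tendsto_of_tendsto_of_tendsto_of_le_of_le tendsto_const_nhds h (fun _ => zero_le)
      fun n => (measure_mono fun ω hω => ?_).trans (measure_union_le _ _)
    by_contra hne
    simp only [Set.mem_union, Set.mem_ofPred_eq, not_or, not_not] at hne
    exact hω hne

lemma tendstoInProbability_iff_le_nhds {E : Type*} [TopologicalSpace E] {Y : ℕ → Ω → E} {c : E} :
    TendstoInProbability P Y c ↔ probabilityFilter P Y ≤ 𝓝 c := Iff.rfl

variable {X : ℕ → Ω → ℂ} {μ : Measure ℂ}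

/-- The weak law of large numbers for a bounded continuous function of the `X i`. -/
lemma tendsto_measure_average_sub_ge [IsProbabilityMeasure P] (hlaw : ∀ i, HasLaw (X i) μ P)
    (hindep : iIndepFun X P) (f : ℂ →ᵇ ℝ) {ε : ℝ} (hε : 0 < ε) :
    Tendsto (fun n : ℕ => P {ω | ε ≤ |(∑ i ∈ Finset.range n, f (X i ω)) / n - ∫ w, f w ∂μ|})
      atTop (𝓝 0) := by
  have hfm : Measurable f := f.continuous.measurable
  have hm : ∀ i, AEMeasurable (fun ω => f (X i ω)) P := fun i =>
    hfm.comp_aemeasurable (hlaw i).aemeasurable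
  have hint : Integrable (fun ω => f (X 0 ω)) P :=
    Integrable.of_bound (hm 0).aestronglyMeasurable ‖f‖
      (ae_of_all _ fun ω => f.norm_coe_le_norm _)
  have hlln := strong_law_ae_real (fun i ω => f (X i ω)) hint
    (fun i j hij => (hindep.indepFun hij).comp hfm hfm)
    (fun i => ((hlaw i).identDistrib (hlaw 0)).comp hfm)
  have hexp : ∫ ω, f (X 0 ω) ∂P = ∫ w, f w ∂μ :=
    (hlaw 0).integral_comp hfm.aestronglyMeasurable
  rw [hexp] at hlln
  have h := tendstoInMeasure_of_tendsto_ae (fun n => ?_) hlln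
  · have h' := tendstoInMeasure_iff_norm.1 h ε hε
    exact h'
  · refine AEMeasurable.aestronglyMeasurable ?_
    exact (Finset.aemeasurable_fun_sum _ fun i _ => hm i).div_const _

variable {k : ℕ → ℕ}

lemma tendstoInProbability_zeroMeasure_of_ne_dirac [IsProbabilityMeasure P]
    {μ : ProbabilityMeasure ℂ}
    (hlaw : ∀ i, HasLaw (X i) (μ : Measure ℂ) P) (hindep : iIndepFun X P)
    (hμ : ∀ x, (μ : Measure ℂ) ≠ Measure.dirac x)
    (hk : ∀ C : ℝ, 0 < C → Tendsto (fun n : ℕ => C ^ k n / (n : ℝ)) atTop (𝓝 0))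
    (hk' : Tendsto (fun n : ℕ => k n * (Real.log (1 + n) + 1) / (n : ℝ)) atTop (𝓝 0)) :
    TendstoInProbability P (fun n ω => zeroMeasure (fun i => X i ω) n (k n)) μ.toFiniteMeasure := by
  have hkn : Tendsto (fun n : ℕ => (k n : ℝ) / n) atTop (𝓝 0) := by
    refine squeeze_zero (fun n => by positivity) (fun n => ?_) hk'
    have : 0 ≤ Real.log (1 + n) := Real.log_nonneg (by simp)
    gcongr
    exact le_mul_of_one_le_right (by positivity) (by linarith)
  have hhalf : ∀ᶠ n : ℕ in atTop, 0 < n ∧ 2 * k n ≤ n := by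
    filter_upwards [hkn.eventually (eventually_lt_nhds (show (0 : ℝ) < 1 / 2 by norm_num)),
      eventually_gt_atTop 0] with n hn hn0
    have hn' : (0 : ℝ) < n := by exact_mod_cast hn0
    rw [div_lt_iff₀ hn'] at hn
    refine ⟨hn0, ?_⟩
    have : (2 : ℝ) * k n ≤ n := by linarith
    exact_mod_cast this
  have : IsProbabilityMeasure (μ.toFiniteMeasure : Measure ℂ) :=
    inferInstanceAs (IsProbabilityMeasure (μ : Measure ℂ))
  rw [tendstoInProbability_iff_le_nhds]
  refine le_nhds_of_tendsto_bump ?_ fun c R hR => ?_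
  · refine tendsto_const_nhds.congr' ?_
    filter_upwards [hhalf] with n hn
    symm
    refine (congrArg P (Set.eq_empty_of_forall_notMem fun ω hω => ?_)).trans measure_empty
    exact hω (isProbabilityMeasure_zeroMeasure _ (by omega))
  · rw [Metric.tendsto_nhds]
    intro ε hε
    set η := ε / 3 / (4 / (Real.pi * R ^ 2)) with hη
    have hη0 : 0 < η := by positivity
    have hlim := (tendsto_measure_integral_logRatio (R := 2 * R) hlaw hindep hμ hk hk' c hη0).add
      (tendsto_measure_average_sub_ge hlaw hindep (bumpBCF hR c) (show 0 < ε / 3 by positivity))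
    rw [add_zero] at hlim
    refine tendsto_of_tendsto_of_tendsto_of_le_of_le' tendsto_const_nhds hlim
      (Eventually.of_forall fun _ => zero_le) ?_
    filter_upwards [hhalf, hkn.eventually (eventually_lt_nhds (show (0 : ℝ) < ε / 6 by positivity))]
      with n hn hkε
    refine (measure_mono fun ω hω => ?_).trans (measure_union_le _ _)
    by_contra hne
    simp only [Set.mem_union, Set.mem_ofPred_eq, not_or, not_lt, not_le] at hne
    obtain ⟨h1, h2⟩ := hne
    refine hω ?_
    have hn' : (0 : ℝ) < n := by exact_mod_cast hn.1
    have h3 := abs_integral_zeroMeasure_bump_sub_le (fun i => X i ω) hn.1 hn.2 c hR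
    have h4 : 4 / (Real.pi * R ^ 2) *
        ((∫ z in Metric.ball c (2 * R), |logRatio (fun i => X i ω) n (k n) z|) / n) ≤ ε / 3 := by
      rw [mul_comm, ← le_div_iff₀ (by positivity), div_le_iff₀ hn']
      exact h1
    have h3' := abs_le.1 h3
    have h2' := abs_lt.1 h2
    change dist (∫ w, bump R ‖c - w‖ ∂(zeroMeasure (fun i => X i ω) n (k n) : Measure ℂ))
      (∫ w, bump R ‖c - w‖ ∂(μ : Measure ℂ)) < ε
    change -(ε / 3) < (∑ i ∈ Finset.range n, bump R ‖c - X i ω‖) / n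
        - ∫ w, bump R ‖c - w‖ ∂(μ : Measure ℂ) ∧ (∑ i ∈ Finset.range n, bump R ‖c - X i ω‖) / n
        - ∫ w, bump R ‖c - w‖ ∂(μ : Measure ℂ) < ε / 3 at h2'
    rw [Real.dist_eq]
    exact abs_lt.2 ⟨by linarith [h3'.1, h2'.1], by linarith [h3'.2, h2'.2]⟩

/-- If `μ` is a point mass, all the roots coincide almost surely, and the zeros of the derivatives
sit at the same point. -/
lemma tendstoInProbability_zeroMeasure_of_eq_dirac {μ : ProbabilityMeasure ℂ} {x : ℂ}
    (hlaw : ∀ i, HasLaw (X i) (μ : Measure ℂ) P) (hμ : (μ : Measure ℂ) = Measure.dirac x)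
    (hk : ∀ᶠ n : ℕ in atTop, k n < n) :
    TendstoInProbability P (fun n ω => zeroMeasure (fun i => X i ω) n (k n)) μ.toFiniteMeasure := by
  have hX : ∀ᵐ ω ∂P, ∀ i, X i ω = x := by
    rw [ae_all_iff]
    intro i
    have h := hlaw i
    rw [hμ] at h
    exact h.ae_eq_of_dirac
  have hpm : μ.toFiniteMeasure = pointMass x := Subtype.ext hμ
  intro U hU
  refine tendsto_const_nhds.congr' ?_
  filter_upwards [hk] with n hn
  symm
  refine measure_eq_zero_iff_ae_notMem.2 (hX.mono fun ω h hω => hω ?_)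
  rw [zeroMeasure_congr (fun i _ => h i), zeroMeasure_const x hn, ← hpm]
  exact mem_of_mem_nhds hU

end Probability

end RandomRoots


theorem theorem1p1 {Ω : Type*} [MeasurableSpace Ω] (P : Measure Ω) [IsProbabilityMeasure P]
    (μ : ProbabilityMeasure ℂ) (X : ℕ → Ω → ℂ)
    (hlaw : ∀ i, HasLaw (X i) (μ : Measure ℂ) P) (hindep : iIndepFun X P)
    (k : ℕ → ℕ)
    (hk : ∀ᶠ n : ℕ in atTop, (k n : ℝ) ≤ Real.log n / (5 * Real.log (Real.log n))) :
    RandomRoots.TendstoInProbability P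
      (fun n ω => RandomRoots.zeroMeasure (fun i => X i ω) n (k n)) μ.toFiniteMeasure := by
  by_cases hμ : ∃ x, (μ : Measure ℂ) = Measure.dirac x
  · obtain ⟨x, hx⟩ := hμ
    refine RandomRoots.tendstoInProbability_zeroMeasure_of_eq_dirac hlaw hx ?_
    filter_upwards [(RandomRoots.tendsto_pow_div_of_le_log_div_log_log hk two_pos).eventually
      (eventually_lt_nhds one_pos), eventually_gt_atTop 0] with n hn hn0
    have hn' : (0 : ℝ) < n := by exact_mod_cast hn0
    rw [div_lt_one hn'] at hn
    exact Nat.lt_two_pow_self.trans (by exact_mod_cast hn)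
  · push Not at hμ
    exact RandomRoots.tendstoInProbability_zeroMeasure_of_ne_dirac hlaw hindep hμ
      (fun C hC => RandomRoots.tendsto_pow_div_of_le_log_div_log_log hk hC)
      (RandomRoots.tendsto_mul_log_div_of_le_log_div_log_log hk)
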